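/- Let $A$ and $B$ be finitely generated, residually finite, amenable groups and let $G=A\star B$ be their free product. A length function on $G$ is a function $\ell:G\to[0,\infty)$ with $\ell(gh)\le\ell(g)+\ell(h)$, $\ell(g^{-1})=\ell(g)$ and $\ell(g)=0\iff g=e$; it is proper if all its balls are finite. It induces on a quotient $G/N$ the length $\ell_{G/N}(\bar g)=\inf_{h\in N}\ell(gh)$ and the metric $d(\bar g,\bar h)=\ell_{G/N}(\bar g^{-1}\bar h)$. A box space of $G$ with respect to a sequence $(N_n)_{n\in\mathbb N}$ of finite-index normal subgroups with trivial intersection is a coarse disjoint union $X$ of the metric spaces $G/N_n$ (all metrized by one proper length $\ell$ on $G$), i.e. a metric space $X$ with a map $p:X\to\mathbb N$ such that each $p^{-1}(n)$ is isometric to $G/N_n$, such that $|2^{p(x)}-2^{p(y)}|\le\rho(d(x,y))$ for all $x,y\in X$ and some nondecreasing $\rho:[0,\infty)\to[0,\infty)$ tending to infinity, and such that for all $n\ne m$ and $R>0$ the set $\{x\in p^{-1}(n): d(x,p^{-1}(m))\le R\}$ is bounded. Then there is a sequence $(N_n)_{n\in\mathbb N}$ of finite-index normal subgroups of $G$ with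 trivial intersection which is faithful (every nontrivial $g\in G$ acts nontrivially by left translation on $G/N_n$ for all but finitely many $n$), such that box spaces of $G$ with respect to $(N_n)_n$ exist and every such box space $X$ 1. coarsely embeds into a Hilbert space: there are a Hilbert space $H$, a map $F:X\to H$ and nondecreasing functions $\rho_\pm:[0,\infty)\to[0,\infty)$ tending to infinity with $\rho_-(d(x,x'))\le\|F(x)-F(x')\|\le\rho_+(d(x,x'))$ for all $x,x'\in X$; 2. has bounded geometry: for each $R$ the balls of radius $R$ in $X$ are finite of uniformly bounded cardinality; 3. does not have property (A) if $|A|,|B|\ge 3$: it is not true that for all $R,\varepsilon>0$ there exist $S>0$ and $\varphi:X\to\ell^2(X)$ with $\|\varphi(x)\|=1$, with $\varphi(x)$ supported in the ball $B_S(x)$ for all $x\in X$, and with $|1-\langle\varphi(x_1),\varphi(x_2)\rangle|\le\varepsilon$ whenever $d(x_1,x_2)\le R$. Moreover $G$ is non-amenable if $|A|,|B|\ge3$. -/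

import Mathlib

open scoped NNReal ENNReal

universe u v w

noncomputable section

namespace BoxSpaces

/-! ## Coarse embeddings -/

/-- A control function: nondecreasing and proper, i.e. tending to infinity at infinity. -/
def IsControl (ρ : ℝ≥0 → ℝ≥0) : Prop :=
  Monotone ρ ∧ Filter.Tendsto ρ Filter.atTop Filter.atTop

/-- `X` coarsely embeds into `Y`. -/
def CoarselyEmbeds (X Y : Type*) [MetricSpace X] [MetricSpace Y] : Prop :=
  ∃ (F : X → Y) (r R : ℝ≥0 → ℝ≥0), IsControl r ∧ IsControl R ∧
    ∀ x x' : X, r (nndist x x') ≤ nndist (F x) (F x') ∧ nndist (F x) (F x') ≤ R (nndist x x')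

/-- `X` coarsely embeds into a Hilbert space. -/
def CoarselyEmbedsIntoHilbert (X : Type w) [MetricSpace X] : Prop :=
  ∃ (H : Type w) (_ : NormedAddCommGroup H) (_ : InnerProductSpace ℂ H) (_ : CompleteSpace H),
    CoarselyEmbeds X H

/-! ## Bounded geometry and property (A) -/

/-- Bounded geometry: balls of a given radius are finite, with uniformly bounded cardinality. -/
def BoundedGeometry (X : Type*) [MetricSpace X] : Prop :=
  ∀ R : ℝ, ∃ M : ℕ, ∀ x : X, (Metric.closedBall x R).encard ≤ M

/-- Property (A), in the form used for discrete metric spaces of bounded geometry. -/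
def HasPropertyA (X : Type*) [MetricSpace X] : Prop :=
  ∀ R > (0 : ℝ), ∀ ε > (0 : ℝ), ∃ S > (0 : ℝ), ∃ φ : X → lp (fun _ : X => ℂ) 2,
    (∀ x, ‖φ x‖ = 1) ∧
    (∀ x₁ x₂, dist x₁ x₂ ≤ R → ‖1 - inner ℂ (φ x₁) (φ x₂)‖ ≤ ε) ∧
    (∀ x, {y | φ x y ≠ 0} ⊆ Metric.closedBall x S)

/-! ## Amenability -/

/-- The left regular representation `(λ(g)ξ)(x) = ξ(g⁻¹x)` on `ℓ²(G)`. -/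
def leftRegular {G : Type*} [Group G] (g : G) (ξ : lp (fun _ : G => ℂ) 2) :
    lp (fun _ : G => ℂ) 2 :=
  ⟨fun x => ξ (g⁻¹ * x), by
    have h : (0 : ℝ) < (2 : ℝ≥0∞).toReal := by norm_num
    have hξ := (memℓp_gen_iff h).1 (lp.memℓp ξ)
    exact memℓp_gen ((Equiv.mulLeft g⁻¹).summable_iff.2 hξ)⟩

/-- A discrete group is amenable if its left regular representation has almost invariant unit
vectors. (Balls of a proper length function are finite and every finite set lies in such a ball.) -/
def IsAmenable (G : Type*) [Group G] : Prop :=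
  ∀ (E : Finset G), ∀ ε > (0 : ℝ), ∃ ξ : lp (fun _ : G => ℂ) 2,
    ‖ξ‖ = 1 ∧ ∀ g ∈ E, ‖leftRegular g ξ - ξ‖ ≤ ε

/-! ## Length functions (these are Mathlib's `GroupNorm`s) and quotient lengths -/

/-- A length function is proper if its balls are finite. -/
def IsProperLength {G : Type*} [Group G] (l : GroupNorm G) : Prop :=
  ∀ R : ℝ, {g : G | l g ≤ R}.Finite

/-- The infimum of a length function over a coset of `N`. -/
def cosetLength {G : Type*} [Group G] (l : GroupNorm G) (N : Subgroup G) (q : G ⧸ N) : ℝ :=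
  ⨅ g : {g : G // (g : G ⧸ N) = q}, l g

section
variable {G : Type*} [Group G] (l : GroupNorm G) (N : Subgroup G)

lemma cosetLength_le (g : G) : cosetLength l N (g : G ⧸ N) ≤ l g :=
  ciInf_le (f := fun k : {k : G // (k : G ⧸ N) = (g : G ⧸ N)} => l k)
    ⟨0, by rintro _ ⟨k, rfl⟩; exact apply_nonneg l _⟩ ⟨g, rfl⟩

lemma exists_cosetLength_eq (hl : IsProperLength l) (q : G ⧸ N) :
    ∃ g : G, (g : G ⧸ N) = q ∧ l g = cosetLength l N q := by
  obtain ⟨g₀, hg₀⟩ := QuotientGroup.mk_surjective q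
  have hfin : {g : G | l g ≤ l g₀ ∧ (g : G ⧸ N) = q}.Finite :=
    (hl (l g₀)).subset fun g hg => hg.1
  obtain ⟨g, ⟨hg1, hg2⟩, hmin⟩ :=
    Set.exists_min_image _ (fun g => l g) hfin ⟨g₀, le_refl _, hg₀⟩
  have : Nonempty {k : G // (k : G ⧸ N) = q} := ⟨⟨g₀, hg₀⟩⟩
  refine ⟨g, hg2, le_antisymm (le_ciInf ?_) ?_⟩
  · rintro ⟨k, hk⟩
    rcases le_total (l k) (l g₀) with h | h
    · exact hmin k ⟨h, hk⟩
    · exact hg1.trans h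
  · subst hg2
    exact cosetLength_le l N g

/-- The quotient length induced by a proper length function on the quotient by a normal
subgroup: `q ↦ inf {l g | g ∈ q}`. -/
def quotientLength (hl : IsProperLength l) [N.Normal] : GroupNorm (G ⧸ N) where
  toFun := cosetLength l N
  map_one' := by
    refine le_antisymm ?_ (Real.iInf_nonneg fun _ => apply_nonneg l _)
    have h := cosetLength_le l N 1
    rwa [map_one_eq_zero l] at h
  mul_le' x y := by
    obtain ⟨g, rfl, hg⟩ := exists_cosetLength_eq l N hl x
    obtain ⟨h, rfl, hh⟩ := exists_cosetLength_eq l N hl y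
    rw [← hg, ← hh]
    exact (cosetLength_le l N (g * h)).trans (map_mul_le_add l g h)
  inv' := by
    have key : ∀ x : G ⧸ N, cosetLength l N x⁻¹ ≤ cosetLength l N x := by
      intro x
      obtain ⟨g, rfl, hg⟩ := exists_cosetLength_eq l N hl x
      rw [← hg, ← map_inv_eq_map l g]
      exact cosetLength_le l N g⁻¹
    intro x
    refine le_antisymm (key x) ?_
    have h := key x⁻¹
    rwa [inv_inv] at h
  eq_one_of_map_eq_zero' x hx := by
    obtain ⟨g, rfl, hg⟩ := exists_cosetLength_eq l N hl x
    rw [eq_one_of_map_eq_zero l (hg.trans hx)]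
    rfl

end

/-! ## Coarse disjoint unions and box spaces -/

/-- The metric space `X` is a coarse disjoint union of the metric spaces `Y 0, Y 1, …`, where `ℕ`
carries the distance `|2 ^ n - 2 ^ m|`. -/
def IsCoarseDisjointUnion (Y : ℕ → Type*) [∀ n, MetricSpace (Y n)]
    (X : Type*) [MetricSpace X] : Prop :=
  ∃ p : X → ℕ,
    (∀ n, Nonempty ({x : X // p x = n} ≃ᵢ Y n)) ∧
    (∃ ρ : ℝ≥0 → ℝ≥0, IsControl ρ ∧
      ∀ x y : X, |(2 : ℝ) ^ p x - (2 : ℝ) ^ p y| ≤ ρ (nndist x y)) ∧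
    (∀ R > (0 : ℝ), ∀ n m : ℕ, n ≠ m →
      Bornology.IsBounded
        {x : X | p x = n ∧ Metric.infEDist x {y | p y = m} ≤ ENNReal.ofReal R})

/-- The metric space `X` is a box space of `G` with respect to the sequence `N` of finite-index
normal subgroups: a coarse disjoint union of the quotients `G ⧸ N n`, each with the left-invariant
metric of the quotient length induced by one and the same proper length function on `G`. -/
def IsBoxSpace {G : Type*} [Group G] (N : ℕ → FiniteIndexNormalSubgroup G)
    (X : Type*) [MetricSpace X] : Prop :=
  ∃ (l : GroupNorm G) (hl : IsProperLength l),
    letI : ∀ n, MetricSpace (G ⧸ (N n).toSubgroup) := fun n =>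
      (quotientLength l (N n).toSubgroup hl).toNormedGroup.toMetricSpace
    IsCoarseDisjointUnion (fun n => G ⧸ (N n).toSubgroup) X

/-- The sequence of quotients `G ⧸ N n` is faithful: every nontrivial element of `G` acts
nontrivially by left translation on all but finitely many of them. -/
def IsFaithfulSequence {G : Type*} [Group G] (N : ℕ → FiniteIndexNormalSubgroup G) : Prop :=
  ∀ g : G, g ≠ 1 → {n : ℕ | ∀ q : G ⧸ (N n).toSubgroup, g • q = q}.Finite

end BoxSpaces

end

noncomputable section

namespace BoxSpaces

open Monoid (Coprod)

/-! ## Mod 2 chains on finite groups -/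

section Chains

/-! Let `G = A ∗ B` act on its Bass-Serre tree, whose edges are the elements of `G`. For a
finite-index normal subgroup `M`, the quotient graph has edge set `G ⧸ M`, and each `g` labels a
path from the edge `1` to the edge `g`. Recording mod 2 the edges met at the vertices of type `i`
gives `pathChain M i g`. On `M` the two chains agree and give the mod 2 homology class of a loop;
its kernel is `homologyCover M`.

Each such cover raises the girth (`HasGirth.homologyCover`). By residual finiteness there are `M n`
eventually avoiding each nontrivial element of the factors. Iterating the cover `n` times over `M n`
gives girth at least `n`, so every nontrivial element of `G` eventually leaves the subgroups. One
cover more gives `N n`.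

Hilbert metrics on `G ⧸ N n` come from walls. Translates of finite sets of edges at a vertex cut a
chain with parity 0 or 1; the weighted number of odd cuts is `energy`, a squared Euclidean distance
(`exists_sum_sq_eq_energy`). For infinite factors the vertices of the quotients have unbounded
valency, so amenability enters here. The cutting sets are Følner sets with summable boundary ratios,
which bounds the energy of every fixed `g` uniformly in the quotient
(`IsCutFamily.exists_energy_le`). Conversely, if `g` has small energy and lies outside `M`, its
chain contains the edge `1` together with a second edge at the same vertex, a bounded factor element
`s` away; multiplying by `s⁻¹` shortens the chain. After boundedly many steps only a short cycle is
left, and large girth kills it (`IsCutFamily.exists_finset_of_ncard_le`). These two bounds form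
`IsUniformlyHilbertian`, which mentions no length function and hence serves every box space.

Property (A) of a box space passes to almost invariant vectors on `G`, by lifting functions from a
large quotient and averaging (`IsBoxCoordinates.isAmenable_of_hasPropertyA`). A paradoxical
decomposition excludes these when both factors have at least three elements
(`not_isAmenable_coprod`). -/

open scoped Classical in
/-- The mod 2 chain consisting of a single point. -/
def pointChain {P : Type*} (q : P) : P → ZMod 2 := fun p => if p = q then 1 else 0

lemma pointChain_self {P : Type*} (q : P) : pointChain q q = 1 := by simp [pointChain]

lemma pointChain_of_ne {P : Type*} {p q : P} (h : p ≠ q) : pointChain q p = 0 := by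
  simp [pointChain, h]

lemma pointChain_mul {P : Type*} [Group P] (g q p : P) :
    pointChain (g * q) p = pointChain q (g⁻¹ * p) := by
  have h : p = g * q ↔ g⁻¹ * p = q := inv_mul_eq_iff_eq_mul.symm
  simp only [pointChain]
  split_ifs <;> tauto

lemma zmod_two_eq_one {x : ZMod 2} (h : x ≠ 0) : x = 1 := by
  revert x; decide

/-- The coboundary `q ↦ (pointChain 1 + pointChain q, q)` of a point, as a homomorphism into the
lamplighter group over `P`. -/
def coboundaryHom (P : Type*) [Group P] :
    P →* RegularWreathProduct (Multiplicative (ZMod 2)) P where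
  toFun q := ⟨fun p => Multiplicative.ofAdd (pointChain 1 p + pointChain q p), q⟩
  map_one' := by
    ext p
    · exact CharTwo.add_self_eq_zero (R := ZMod 2) _
    · rfl
  map_mul' q r := by
    ext p
    · change pointChain 1 p + pointChain (q * r) p = (pointChain 1 p + pointChain q p) +
        (pointChain 1 (q⁻¹ * p) + pointChain r (q⁻¹ * p))
      rw [← pointChain_mul, ← pointChain_mul, mul_one]
      have := CharTwo.add_self_eq_zero (R := ZMod 2) (pointChain q p)
      linear_combination -this
    · rfl

end Chains

/-! ### Path chains in quotients of the Bass-Serre tree and mod 2 homology covers -/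

section FreeProduct

variable {A : Type u} {B : Type v} [Group A] [Group B]

variable (A B) in
/-- The two free factors of `A ∗ B`. -/
def factor (i : Bool) : Subgroup (Coprod A B) :=
  if i then (Coprod.inl : A →* Coprod A B).range else (Coprod.inr : B →* Coprod A B).range

lemma inl_mem_factor (a : A) : (Coprod.inl a : Coprod A B) ∈ factor A B true := ⟨a, rfl⟩

lemma inr_mem_factor (b : B) : (Coprod.inr b : Coprod A B) ∈ factor A B false := ⟨b, rfl⟩

/-- Induction on elements of `A ∗ B` by multiplying with letters from the left. -/
lemma factor_induction {p : Coprod A B → Prop} (one : p 1)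
    (mul : ∀ i, ∀ s ∈ factor A B i, ∀ g, p g → p (s * g)) (g : Coprod A B) : p g := by
  induction g using Coprod.induction_on' with
  | one => exact one
  | inl_mul a x ih => exact mul true _ (inl_mem_factor a) _ ih
  | inr_mul b x ih => exact mul false _ (inr_mem_factor b) _ ih

variable (M : FiniteIndexNormalSubgroup (Coprod A B))

/-- The homomorphism of `A ∗ B` to the lamplighter group over a finite quotient which twists the
factor with index `i` by a coboundary. -/
def lampHom (i : Bool) : Coprod A B →*
    RegularWreathProduct (Multiplicative (ZMod 2)) (Coprod A B ⧸ M.toSubgroup) :=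
  Coprod.lift
    (((if i then coboundaryHom _ else RegularWreathProduct.inl).comp
      (QuotientGroup.mk' M.toSubgroup)).comp Coprod.inl)
    (((if i then RegularWreathProduct.inl else coboundaryHom _).comp
      (QuotientGroup.mk' M.toSubgroup)).comp Coprod.inr)

/-- The mod 2 chain of edges crossed, through vertices of type `i`, by a path with label `g` in the
quotient of the Bass-Serre tree of `A ∗ B` by `M`. -/
def pathChain (i : Bool) (g : Coprod A B) (p : Coprod A B ⧸ M.toSubgroup) : ZMod 2 :=
  Multiplicative.toAdd ((lampHom M i g).left p)

lemma lampHom_right (i : Bool) (g : Coprod A B) :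
    (lampHom M i g).right = (g : Coprod A B ⧸ M.toSubgroup) := by
  have : (RegularWreathProduct.rightHom).comp (lampHom M i) = QuotientGroup.mk' M.toSubgroup := by
    apply Coprod.hom_ext <;> ext x <;> cases i <;> rfl
  exact DFunLike.congr_fun this g

lemma pathChain_mul (i : Bool) (g h : Coprod A B) (p : Coprod A B ⧸ M.toSubgroup) :
    pathChain M i (g * h) p = pathChain M i g p + pathChain M i h ((g : _ ⧸ M.toSubgroup)⁻¹ * p) := by
  simp only [pathChain, map_mul, RegularWreathProduct.mul_left, lampHom_right]
  rfl

lemma pathChain_one (i : Bool) (p : Coprod A B ⧸ M.toSubgroup) : pathChain M i 1 p = 0 := by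
  simp only [pathChain, map_one]; rfl

lemma pathChain_same {i : Bool} {s : Coprod A B} (hs : s ∈ factor A B i)
    (p : Coprod A B ⧸ M.toSubgroup) :
    pathChain M i s p = pointChain 1 p + pointChain (s : _ ⧸ M.toSubgroup) p := by
  cases i <;> obtain ⟨a, rfl⟩ := hs <;> rfl

lemma pathChain_other {i j : Bool} (hij : i ≠ j) {s : Coprod A B} (hs : s ∈ factor A B j)
    (p : Coprod A B ⧸ M.toSubgroup) : pathChain M i s p = 0 := by
  cases i <;> cases j <;> first | exact absurd rfl hij | (obtain ⟨a, rfl⟩ := hs; rfl)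

/-- The sum telescopes: every intermediate edge is counted once when a letter arrives at it and once
when the next letter leaves it. -/
lemma pathChain_add (g : Coprod A B) (p : Coprod A B ⧸ M.toSubgroup) :
    pathChain M true g p + pathChain M false g p =
      pointChain 1 p + pointChain (g : _ ⧸ M.toSubgroup) p := by
  induction g using factor_induction generalizing p with
  | one => simp [pathChain_one, CharTwo.add_self_eq_zero]
  | mul i s hs g ih =>
    rw [pathChain_mul, pathChain_mul]
    have h := ih ((s : _ ⧸ M.toSubgroup)⁻¹ * p)
    rw [← pointChain_mul, ← pointChain_mul, mul_one] at h
    have h2 := CharTwo.add_self_eq_zero (R := ZMod 2) (pointChain (s : _ ⧸ M.toSubgroup) p)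
    rw [QuotientGroup.mk_mul]
    cases i
    · rw [pathChain_same M hs, pathChain_other M (by decide) hs]
      linear_combination h + h2
    · rw [pathChain_same M hs, pathChain_other M (by decide) hs]
      linear_combination h + h2

/-- For a closed path the two end edges cancel, so each edge is counted with the same parity from
both of its ends. -/
lemma pathChain_of_mem {g : Coprod A B} (hg : g ∈ M) (i : Bool) (p : Coprod A B ⧸ M.toSubgroup) :
    pathChain M i g p = pathChain M true g p := by
  have h := pathChain_add M g p
  rw [(QuotientGroup.eq_one_iff g).2 hg, CharTwo.add_self_eq_zero] at h
  cases i
  · exact (CharTwo.add_eq_zero.1 h).symm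
  · rfl

/-- The elements of `M` whose mod 2 path chain vanishes: the group of the mod 2 homology cover. -/
def homologyCover : FiniteIndexNormalSubgroup (Coprod A B) :=
  .ofSubgroup (lampHom M true).ker

lemma mem_homologyCover {g : Coprod A B} :
    g ∈ homologyCover M ↔ g ∈ M ∧ ∀ i p, pathChain M i g p = 0 := by
  have h1 : g ∈ homologyCover M ↔ lampHom M true g = 1 := Iff.rfl
  have h2 : g ∈ M ↔ (g : _ ⧸ M.toSubgroup) = 1 := (QuotientGroup.eq_one_iff g).symm
  rw [h1, RegularWreathProduct.ext_iff, lampHom_right, RegularWreathProduct.one_right, ← h2]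
  constructor
  · rintro ⟨h, hg⟩
    exact ⟨hg, fun i p => (pathChain_of_mem M hg i p).trans (congrFun h p)⟩
  · rintro ⟨hg, h⟩
    exact ⟨funext fun p => h true p, hg⟩

lemma homologyCover_le : homologyCover M ≤ M := fun _ hg => ((mem_homologyCover M).1 hg).1

/-- Elements of a factor fix a vertex of the tree and have trivial homology class. Hence the letters
allowed in alternating words are the same for `M` and for its cover. -/
lemma mem_homologyCover_of_mem_factor {i : Bool} {s : Coprod A B} (hs : s ∈ factor A B i)
    (hM : s ∈ M) : s ∈ homologyCover M := by
  refine (mem_homologyCover M).2 ⟨hM, fun j p => ?_⟩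
  rw [pathChain_of_mem M hM, ← pathChain_of_mem M hM i, pathChain_same M hs,
    (QuotientGroup.eq_one_iff s).2 hM, CharTwo.add_self_eq_zero]

/-! ## Alternating words and girth -/

/-- Words with letters alternately from the two factors, none of them in `K`. -/
def IsAlternating (K : Subgroup (Coprod A B)) (w : List (Bool × Coprod A B)) : Prop :=
  w.IsChain (fun x y => x.1 ≠ y.1) ∧ ∀ x ∈ w, x.2 ∈ factor A B x.1 ∧ x.2 ∉ K

/-- The product of the letters of a word. -/
def wordProd (w : List (Bool × Coprod A B)) : Coprod A B := (w.map Prod.snd).prod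

lemma wordProd_append (w w' : List (Bool × Coprod A B)) :
    wordProd (w ++ w') = wordProd w * wordProd w' := by simp [wordProd]

lemma wordProd_cons (x : Bool × Coprod A B) (w : List (Bool × Coprod A B)) :
    wordProd (x :: w) = x.2 * wordProd w := by simp [wordProd]

lemma IsAlternating.mono {K L : Subgroup (Coprod A B)} {w : List (Bool × Coprod A B)}
    (hw : IsAlternating K w) (h : ∀ i, ∀ s ∈ factor A B i, s ∈ L → s ∈ K) : IsAlternating L w :=
  ⟨hw.1, fun x hx => ⟨(hw.2 x hx).1, fun hL => (hw.2 x hx).2 (h _ _ (hw.2 x hx).1 hL)⟩⟩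

lemma IsAlternating.infix {K : Subgroup (Coprod A B)} {w w' : List (Bool × Coprod A B)}
    (hw : IsAlternating K w) (h : w' <:+: w) : IsAlternating K w' :=
  ⟨hw.1.infix h, fun x hx => hw.2 x (h.subset hx)⟩

/-- No nonempty alternating word of length at most `r` without letters in `M` has product in `M`. -/
def HasGirth (r : ℕ) : Prop :=
  ∀ w : List (Bool × Coprod A B), IsAlternating M.toSubgroup w → w ≠ [] → w.length ≤ r →
    wordProd w ∉ M

lemma HasGirth.mono {r r' : ℕ} (h : HasGirth M r) (hr : r' ≤ r) : HasGirth M r' :=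
  fun w h1 h2 h3 => h w h1 h2 (h3.trans hr)

lemma hasGirth_zero : HasGirth M 0 :=
  fun _ _ hne hlen => absurd (List.length_eq_zero_iff.1 (Nat.le_zero.1 hlen)) hne

/-- A short path leaving the edge `1` through the vertex of the other type cannot return to it: a
letter of type `i` has a nonempty prefix before it, and by the girth neither of its two edges is
`1`. -/
lemma HasGirth.pathChain_wordProd_one {r : ℕ} (h : HasGirth M r) (i : Bool)
    (w : List (Bool × Coprod A B)) (hw : IsAlternating M.toSubgroup w) (hlen : w.length ≤ r)
    (hhead : ∀ x ∈ w.head?, x.1 ≠ i) : pathChain M i (wordProd w) 1 = 0 := by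
  induction w using List.reverseRecOn with
  | nil => exact pathChain_one M i 1
  | append_singleton w y ih =>
    have hw' : IsAlternating M.toSubgroup w := hw.infix (List.prefix_append _ _).isInfix
    rw [List.length_append, List.length_singleton] at hlen
    rw [wordProd_append, pathChain_mul, ih hw' (by lia) (by
      intro x hx
      refine hhead x ?_
      cases w <;> simp_all), zero_add, mul_one]
    have hy : wordProd [y] = y.2 := by simp [wordProd]
    have hyf := (hw.2 y (by simp)).1
    rw [hy]
    rcases eq_or_ne i y.1 with rfl | hi
    · have hne : w ≠ [] := by
        rintro rfl
        simp at hhead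
      have h1 := h w hw' hne (by lia)
      have h2 := h _ hw (by simp) (by simpa using hlen)
      rw [wordProd_append, hy] at h2
      rw [pathChain_same M hyf, pointChain_of_ne, pointChain_of_ne, add_zero]
      · rw [ne_eq, inv_eq_iff_mul_eq_one, ← QuotientGroup.mk_mul]
        exact fun h' => h2 ((QuotientGroup.eq_one_iff _).1 h')
      · rw [ne_eq, inv_eq_one]
        exact fun h' => h1 ((QuotientGroup.eq_one_iff _).1 h')
    · exact pathChain_other M hi hyf _

/-- Passing to the mod 2 homology cover increases the girth. -/
lemma HasGirth.homologyCover {r : ℕ} (h : HasGirth M r) :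
    HasGirth (homologyCover M) (r + 1) := by
  intro w hw hne hlen hmem
  replace hw : IsAlternating M.toSubgroup w :=
    hw.mono fun i s hs hM => mem_homologyCover_of_mem_factor M hs hM
  obtain ⟨x, t, rfl⟩ := List.exists_cons_of_ne_nil hne
  have h0 := ((mem_homologyCover M).1 hmem).2 x.1 x.2
  have hx := hw.2 x (by simp)
  have hx1 : (x.2 : _ ⧸ M.toSubgroup) ≠ 1 := fun h' => hx.2 ((QuotientGroup.eq_one_iff _).1 h')
  -- The coefficient is read off at the edge reached by the first letter: this letter contributes 1,
  -- and the remaining path, of length at most `r`, contributes 0.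
  rw [wordProd_cons, pathChain_mul, inv_mul_cancel, pathChain_same M hx.1, pointChain_self,
    pointChain_of_ne hx1, h.pathChain_wordProd_one M x.1 t
      (hw.infix (List.suffix_cons x t).isInfix) (by simpa using hlen)] at h0
  · simp at h0
  · intro y hy
    have := hw.1
    cases t with
    | nil => simp at hy
    | cons z t =>
      simp only [List.head?_cons, Option.mem_def, Option.some.injEq] at hy
      subst hy
      exact (List.isChain_cons_cons.1 this).1.symm

/-! ## Cycles -/

/-- A chain which contains with each edge another one at its vertex of type `i`. -/
def IsEven (i : Bool) (z : Coprod A B ⧸ M.toSubgroup → ZMod 2) : Prop :=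
  ∀ p, z p ≠ 0 → ∃ s ∈ factor A B i, s ∉ M ∧ z (p * (s : _ ⧸ M.toSubgroup)) ≠ 0

/-- A letter of type `i` adds two edges at one vertex, so the coefficients around each vertex of
type `i`, a left coset of the image `H` of the factor, sum to zero. A single nonzero coefficient
there is impossible. -/
lemma isEven_pathChain (i : Bool) (g : Coprod A B) : IsEven M i (pathChain M i g) := by
  classical
  have := Fintype.ofFinite (Coprod A B ⧸ M.toSubgroup)
  set H := (factor A B i).map (QuotientGroup.mk' M.toSubgroup) with hH
  have key : ∀ p, ∑ q with q ∈ H, pathChain M i g (p * q) = 0 := by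
    induction g using factor_induction with
    | one => simp [pathChain_one]
    | mul j s hs g ih =>
      intro p
      simp only [pathChain_mul, Finset.sum_add_distrib, ← mul_assoc, ih, add_zero]
      rcases eq_or_ne i j with rfl | hij
      · have hsH : (s : _ ⧸ M.toSubgroup) ∈ H := ⟨s, hs, rfl⟩
        have h1 : ∀ t ∈ H, ∑ q with q ∈ H, pointChain t (p * q) = if p ∈ H then 1 else 0 := by
          intro t ht
          have h2 : ∀ q, p * q = t ↔ q = p⁻¹ * t := fun q => eq_inv_mul_iff_mul_eq.symm
          simp only [pointChain, h2, Finset.sum_ite_eq', Finset.mem_filter, Finset.mem_univ,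
            true_and, H.mul_mem_cancel_right ht, H.inv_mem_iff]
        simp only [pathChain_same M hs, Finset.sum_add_distrib, h1 1 H.one_mem, h1 _ hsH,
          CharTwo.add_self_eq_zero]
      · simp [pathChain_other M hij hs]
  intro p hp
  by_contra! hcon
  refine hp ?_
  rw [← key p, Finset.sum_eq_single 1, mul_one]
  · intro q hq hq1
    obtain ⟨s, hs, rfl⟩ := (Finset.mem_filter.1 hq).2
    exact hcon s hs fun hsM => hq1 ((QuotientGroup.eq_one_iff s).2 hsM)
  · intro h
    exact absurd (Finset.mem_filter.2 ⟨Finset.mem_univ _, H.one_mem⟩) h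

/-- Evenness at the two types of vertices is used in turn, which keeps the walk inside the support
and without backtracking. -/
lemma exists_walk {z : Coprod A B ⧸ M.toSubgroup → ZMod 2} (hz : ∀ i, IsEven M i z) (n : ℕ) :
    ∀ (i : Bool) (p : Coprod A B ⧸ M.toSubgroup), z p ≠ 0 →
      ∃ w : List (Bool × Coprod A B), IsAlternating M.toSubgroup w ∧ w.length = n ∧
        (∀ x ∈ w.head?, x.1 = i) ∧
        ∀ k, z (p * (wordProd (w.take k) : _ ⧸ M.toSubgroup)) ≠ 0 := by
  induction n with
  | zero => exact fun i p hp => ⟨[], ⟨by simp, by simp⟩, by simp, by simp, by simpa [wordProd]⟩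
  | succ n ih =>
    intro i p hp
    obtain ⟨s, hs, hsM, hsz⟩ := hz i p hp
    obtain ⟨w, hw, hlen, hhead, hwz⟩ := ih (!i) _ hsz
    refine ⟨(i, s) :: w, ⟨List.isChain_cons.2 ⟨?_, hw.1⟩, ?_⟩, by simp [hlen], by simp, ?_⟩
    · intro y hy
      rw [hhead y hy]
      cases i <;> simp
    · rintro x hx
      rcases List.mem_cons.1 hx with rfl | hx
      exacts [⟨hs, hsM⟩, hw.2 x hx]
    · rintro (_ | k)
      · simpa [wordProd] using hp
      · rw [List.take_succ_cons, wordProd_cons, QuotientGroup.mk_mul, ← mul_assoc]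
        exact hwz k

/-- A nonzero even chain has more edges than the girth. -/
lemma HasGirth.eq_zero_of_isEven {r : ℕ} (h : HasGirth M r)
    {z : Coprod A B ⧸ M.toSubgroup → ZMod 2} (hz : ∀ i, IsEven M i z)
    (hcard : (Function.support z).ncard ≤ r) : z = 0 := by
  by_contra hne
  obtain ⟨p, hp⟩ := Function.ne_iff.1 hne
  obtain ⟨w, hw, hlen, -, hwz⟩ := exists_walk M hz (Function.support z).ncard true p hp
  -- A walk with as many steps as the support has edges visits one edge more than that, so some edge
  -- repeats; the letters in between form a closed alternating word too short for the girth.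
  obtain ⟨j, hj, k, hk, hjk, heq⟩ := Finset.exists_ne_map_eq_of_card_lt_of_maps_to
    (s := Finset.range ((Function.support z).ncard + 1))
    (t := (Set.toFinite (Function.support z)).toFinset)
    (f := fun k => p * (wordProd (w.take k) : _ ⧸ M.toSubgroup))
    (by rw [← Set.ncard_eq_toFinset_card]; simp) (fun k _ => by simpa using hwz k)
  wlog hlt : j < k generalizing j k
  · exact this k hk j hj hjk.symm heq.symm (by lia)
  rw [Finset.mem_range] at hk
  have hsplit : w.take k = w.take j ++ (w.take k).drop j := by
    conv_lhs => rw [← List.take_append_drop j (w.take k)]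
    rw [List.take_take, min_eq_left hlt.le]
  have hl : ((w.take k).drop j).length = k - j := by simp; lia
  refine h ((w.take k).drop j)
    (hw.infix ((List.drop_suffix _ _).isInfix.trans (List.take_prefix _ _).isInfix)) ?_ ?_ ?_
  · intro h0
    rw [h0] at hl
    simp at hl
    lia
  · rw [hl]; lia
  · replace heq := mul_left_cancel heq
    rw [hsplit, wordProd_append, QuotientGroup.mk_mul, eq_comm, mul_eq_left] at heq
    exact (QuotientGroup.eq_one_iff _).1 heq

end FreeProduct

/-! ## Weighted cuts -/

section Cuts

variable {A : Type u} {B : Type v} [Group A] [Group B]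

/-- A sequence of Følner sets in each of the factors, starting with a point. -/
structure IsCutFamily (F : Bool → ℕ → Finset (Coprod A B)) : Prop where
  mem_factor : ∀ i k, ∀ s ∈ F i k, s ∈ factor A B i
  zero : ∀ i, F i 0 = {1}
  nonempty : ∀ i k, (F i k).Nonempty
  bounded : open scoped Classical in ∀ i, ∀ s ∈ factor A B i, ∃ C : ℝ, ∀ n,
    ∑ k ∈ Finset.range n,
      ((symmDiff (F i k) ((F i k).image (· * s⁻¹))).card : ℝ) / (F i k).card ≤ C

variable (F : Bool → ℕ → Finset (Coprod A B)) (M : FiniteIndexNormalSubgroup (Coprod A B))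

/-- The parity of the number of edges which a chain has in a translate of the finite set `F i k`. -/
def cutParity (i : Bool) (k : ℕ) (z : Coprod A B ⧸ M.toSubgroup → ZMod 2)
    (p : Coprod A B ⧸ M.toSubgroup) : ZMod 2 :=
  ∑ s ∈ F i k, z (p * (s : _ ⧸ M.toSubgroup))

/-- The weighted number of translates of the sets `F i k`, `k < n`, which cut the chain oddly. -/
def cutNorm (n : ℕ) (i : Bool) (z : Coprod A B ⧸ M.toSubgroup → ZMod 2) : ℝ :=
  ∑ k ∈ Finset.range n, ((Function.support (cutParity F M i k z)).ncard : ℝ) / (F i k).card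

/-- The squared length of an element with respect to the weighted cuts. -/
def energy (n : ℕ) (g : Coprod A B) : ℝ :=
  ∑ i, cutNorm F M n i (pathChain M i g)

lemma cutParity_add (i : Bool) (k : ℕ) (z z' : Coprod A B ⧸ M.toSubgroup → ZMod 2) :
    cutParity F M i k (z + z') = cutParity F M i k z + cutParity F M i k z' := by
  ext p
  simp [cutParity, Finset.sum_add_distrib]

lemma cutParity_translate (i : Bool) (k : ℕ) (z : Coprod A B ⧸ M.toSubgroup → ZMod 2)
    (q p : Coprod A B ⧸ M.toSubgroup) :
    cutParity F M i k (fun p => z (q * p)) p = cutParity F M i k z (q * p) := by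
  simp [cutParity, mul_assoc]

lemma ncard_support_translate {P : Type*} [Group P] (z : P → ZMod 2) (q : P) :
    (Function.support fun p => z (q * p)).ncard = (Function.support z).ncard := by
  rw [← Set.ncard_image_of_injective (Function.support fun p => z (q * p)) (mul_right_injective q)]
  congr 1
  ext p
  simp only [Set.mem_image, Function.mem_support]
  exact ⟨by rintro ⟨p, h, rfl⟩; exact h, fun h => ⟨q⁻¹ * p, by simpa, by simp⟩⟩

lemma cutNorm_nonneg (n : ℕ) (i : Bool) (z : Coprod A B ⧸ M.toSubgroup → ZMod 2) :
    0 ≤ cutNorm F M n i z :=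
  Finset.sum_nonneg fun _ _ => by positivity

lemma cutNorm_zero (n : ℕ) (i : Bool) : cutNorm F M n i 0 = 0 := by
  refine Finset.sum_eq_zero fun k _ => ?_
  have : cutParity F M i k 0 = 0 := by ext; simp [cutParity]
  simp [this]

lemma cutNorm_translate (n : ℕ) (i : Bool) (z : Coprod A B ⧸ M.toSubgroup → ZMod 2)
    (q : Coprod A B ⧸ M.toSubgroup) :
    cutNorm F M n i (fun p => z (q * p)) = cutNorm F M n i z := by
  refine Finset.sum_congr rfl fun k _ => ?_
  rw [← ncard_support_translate (cutParity F M i k z) q]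
  congr 4
  exact funext fun p => cutParity_translate F M i k z q p

lemma cutNorm_add_le (n : ℕ) (i : Bool) (z z' : Coprod A B ⧸ M.toSubgroup → ZMod 2) :
    cutNorm F M n i (z + z') ≤ cutNorm F M n i z + cutNorm F M n i z' := by
  rw [cutNorm, cutNorm, cutNorm, ← Finset.sum_add_distrib]
  refine Finset.sum_le_sum fun k _ => ?_
  rw [← add_div, cutParity_add]
  gcongr
  exact_mod_cast (Set.ncard_le_ncard (Function.support_add _ _) (Set.toFinite _)).trans
    (Set.ncard_union_le _ _)

lemma pathChain_mul_eq (i : Bool) (g h : Coprod A B) :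
    pathChain M i (g * h) = pathChain M i g +
      fun p => pathChain M i h ((g : _ ⧸ M.toSubgroup)⁻¹ * p) :=
  funext fun p => pathChain_mul M i g h p

lemma energy_mul_le (n : ℕ) (g h : Coprod A B) :
    energy F M n (g * h) ≤ energy F M n g + energy F M n h := by
  rw [energy, energy, energy, ← Finset.sum_add_distrib]
  refine Finset.sum_le_sum fun i _ => ?_
  rw [pathChain_mul_eq, ← cutNorm_translate F M n i (pathChain M i h) (g : _ ⧸ M.toSubgroup)⁻¹]
  exact cutNorm_add_le F M n i _ _

/-- The energy formed over `M` descends to the quotient by the cover of `M`. -/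
lemma energy_mul_of_mem (n : ℕ) (g : Coprod A B) {h : Coprod A B} (hh : h ∈ homologyCover M) :
    energy F M n (g * h) = energy F M n g := by
  refine Finset.sum_congr rfl fun i _ => ?_
  congr 1
  ext p
  rw [pathChain_mul, ((mem_homologyCover M).1 hh).2, add_zero]

variable {F}

/-- The cuts by the singleton `F i 0` have weight 1 and count the edges of the chain. -/
lemma IsCutFamily.ncard_support_le (hF : IsCutFamily F) {n : ℕ} (hn : 1 ≤ n) (i : Bool)
    (z : Coprod A B ⧸ M.toSubgroup → ZMod 2) :
    ((Function.support z).ncard : ℝ) ≤ cutNorm F M n i z := by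
  have h := Finset.single_le_sum (s := Finset.range n)
    (f := fun k => ((Function.support (cutParity F M i k z)).ncard : ℝ) / (F i k).card)
    (fun _ _ => by positivity) (Finset.mem_range.2 hn)
  have h0 : cutParity F M i 0 z = z := by
    ext p
    simp [cutParity, hF.zero]
  rwa [h0, hF.zero, Finset.card_singleton, Nat.cast_one, div_one] at h

open scoped Classical in
-- The chain of `s` is the pair of edges `1` and `s`. A translate by `p` can cut it oddly only if
-- `p⁻¹` is the class of some `f` lying in exactly one of `F i k` and `F i k * s⁻¹`.
lemma ncard_support_cutParity_le {i : Bool} {s : Coprod A B} (hs : s ∈ factor A B i) (k : ℕ) :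
    (Function.support (cutParity F M i k (pathChain M i s))).ncard ≤
      (symmDiff (F i k) ((F i k).image (· * s⁻¹))).card := by
  refine le_trans (Set.ncard_le_ncard (t := ((symmDiff (F i k) ((F i k).image (· * s⁻¹))).image
    fun f : Coprod A B => (f : Coprod A B ⧸ M.toSubgroup)⁻¹)) ?_ (Set.toFinite _)) ?_
  · intro p hp
    by_contra hcon
    refine hp ?_
    have hsum : ∀ f ∈ symmDiff (F i k) ((F i k).image (· * s⁻¹)),
        pointChain 1 (p * (f : Coprod A B ⧸ M.toSubgroup)) = 0 := by
      intro f hf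
      refine pointChain_of_ne fun h => hcon ?_
      exact Finset.mem_coe.2 (Finset.mem_image.2 ⟨f, hf, (eq_inv_of_mul_eq_one_left h).symm⟩)
    have h1 := Finset.sum_subset (Finset.inter_subset_left (s₁ := F i k)
      (s₂ := (F i k).image (· * s⁻¹)))
      (f := fun f : Coprod A B => pointChain 1 (p * (f : Coprod A B ⧸ M.toSubgroup))) fun x hx hx' =>
      hsum x (Finset.mem_symmDiff.2 (Or.inl ⟨hx, fun h => hx' (Finset.mem_inter.2 ⟨hx, h⟩)⟩))
    have h2 := Finset.sum_subset (Finset.inter_subset_right (s₁ := F i k)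
      (s₂ := (F i k).image (· * s⁻¹)))
      (f := fun f : Coprod A B => pointChain 1 (p * (f : Coprod A B ⧸ M.toSubgroup))) fun x hx hx' =>
      hsum x (Finset.mem_symmDiff.2 (Or.inr ⟨hx, fun h => hx' (Finset.mem_inter.2 ⟨h, hx⟩)⟩))
    have h3 : ∀ f : Coprod A B,
        pointChain (s : _ ⧸ M.toSubgroup) (p * (f : Coprod A B ⧸ M.toSubgroup)) =
        pointChain 1 (p * ((f * s⁻¹ : Coprod A B) : Coprod A B ⧸ M.toSubgroup)) := by
      intro f
      have : p * (f : Coprod A B ⧸ M.toSubgroup) = s ↔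
          p * ((f * s⁻¹ : Coprod A B) : Coprod A B ⧸ M.toSubgroup) = 1 := by
        rw [QuotientGroup.mk_mul, ← mul_assoc, QuotientGroup.mk_inv, mul_inv_eq_one]
      simp only [pointChain]
      split_ifs <;> tauto
    rw [Finset.sum_image fun _ _ _ _ h => mul_right_cancel h] at h2
    simp only [cutParity, pathChain_same M hs, Finset.sum_add_distrib, h3, ← h1, ← h2,
      CharTwo.add_self_eq_zero]
  · rw [Set.ncard_coe_finset]
    exact Finset.card_image_le

/-- The energy is subadditive, a letter is seen only by the cuts of its own type, and the Følner
sums bound its contribution independently of `M` and `n`. -/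
lemma IsCutFamily.exists_energy_le (hF : IsCutFamily F) (g : Coprod A B) :
    ∃ C : ℝ, ∀ (M : FiniteIndexNormalSubgroup (Coprod A B)) (n : ℕ), energy F M n g ≤ C := by
  classical
  induction g using factor_induction with
  | one =>
    refine ⟨0, fun M n => le_of_eq (Finset.sum_eq_zero fun i _ => ?_)⟩
    rw [← cutNorm_zero F M n i]
    exact congrArg _ (funext fun p => pathChain_one M i p)
  | mul i s hs g ih =>
    obtain ⟨C, hC⟩ := ih
    obtain ⟨C', hC'⟩ := hF.bounded i s hs
    refine ⟨C' + C, fun M n => (energy_mul_le F M n s g).trans (add_le_add ?_ (hC M n))⟩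
    rw [energy, Finset.sum_eq_single i]
    · refine le_trans (Finset.sum_le_sum fun k _ => ?_) (hC' n)
      gcongr
      exact ncard_support_cutParity_le M hs k
    · intro j _ hj
      rw [← cutNorm_zero F M n j]
      exact congrArg _ (funext fun p => pathChain_other M hj hs p)
    · simp

/-- If the edge `1` shared no translate of the first `K` sets with another edge of the chain, all
translates containing it would be odd cuts. For each `k` these have total weight at least 1, so the
norm would be at least `K`. -/
lemma IsCutFamily.exists_ne_zero_of_cutNorm_lt (hF : IsCutFamily F) {n K : ℕ} (hK : K ≤ n)
    {i : Bool} {z : Coprod A B ⧸ M.toSubgroup → ZMod 2} (hz : z 1 ≠ 0)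
    (hlt : cutNorm F M n i z < K)
    (hinj : ∀ k < K, ∀ f ∈ F i k, ∀ f' ∈ F i k, f ≠ f' → f⁻¹ * f' ∉ M) :
    ∃ k < K, ∃ f ∈ F i k, ∃ f' ∈ F i k, f ≠ f' ∧
      z ((f⁻¹ * f' : Coprod A B) : Coprod A B ⧸ M.toSubgroup) ≠ 0 := by
  classical
  by_contra! hcon
  refine hlt.not_ge ?_
  have h1 : ∀ k ∈ Finset.range K,
      (1 : ℝ) ≤ ((Function.support (cutParity F M i k z)).ncard : ℝ) / (F i k).card := by
    intro k hk
    rw [Finset.mem_range] at hk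
    rw [one_le_div (by exact_mod_cast (hF.nonempty i k).card_pos)]
    norm_cast
    have hc : ((F i k).image fun f : Coprod A B => (f : Coprod A B ⧸ M.toSubgroup)⁻¹).card = (F i k).card := by
      refine Finset.card_image_of_injOn fun f hf f' hf' h => ?_
      by_contra hne
      exact hinj k hk f hf f' hf' hne (QuotientGroup.eq.1 (inv_injective h))
    rw [← hc, ← Set.ncard_coe_finset]
    refine Set.ncard_le_ncard ?_ (Set.toFinite _)
    intro p hp
    obtain ⟨f, hf, rfl⟩ := Finset.mem_image.1 (Finset.mem_coe.1 hp)
    rw [Function.mem_support, cutParity, Finset.sum_eq_single f]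
    · rwa [inv_mul_cancel]
    · intro f' hf' hne
      exact hcon k hk f hf f' hf' hne.symm
    · exact fun h => absurd hf h
  calc (K : ℝ) = ∑ _k ∈ Finset.range K, (1 : ℝ) := by simp
    _ ≤ ∑ k ∈ Finset.range K,
        ((Function.support (cutParity F M i k z)).ncard : ℝ) / (F i k).card :=
      Finset.sum_le_sum h1
    _ ≤ _ := Finset.sum_le_sum_of_subset_of_nonneg (Finset.range_subset_range.2 hK)
      fun _ _ _ => by positivity

/-- Up to translation, multiplying by `s⁻¹` toggles exactly the edges `1` and `s`, both of which lie
in the chain. -/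
lemma ncard_support_pathChain_inv_mul_lt {i : Bool} {s g : Coprod A B} (hs : s ∈ factor A B i)
    (hsM : s ∉ M) (h1 : pathChain M i g 1 ≠ 0)
    (h2 : pathChain M i g (s : _ ⧸ M.toSubgroup) ≠ 0) :
    (Function.support (pathChain M i (s⁻¹ * g))).ncard <
      (Function.support (pathChain M i g)).ncard := by
  have hs1 : (s : _ ⧸ M.toSubgroup) ≠ 1 := fun h => hsM ((QuotientGroup.eq_one_iff s).1 h)
  have h : ∀ p, pathChain M i (s⁻¹ * g) ((s : _ ⧸ M.toSubgroup)⁻¹ * p) =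
      pathChain M i g p + (pointChain 1 p + pointChain (s : _ ⧸ M.toSubgroup) p) := by
    intro p
    rw [← pathChain_same M hs]
    have := pathChain_mul M i s (s⁻¹ * g) p
    rw [mul_inv_cancel_left] at this
    rw [this]
    linear_combination -CharTwo.add_self_eq_zero (R := ZMod 2) (pathChain M i s p)
  rw [← ncard_support_translate (pathChain M i (s⁻¹ * g)) (s : _ ⧸ M.toSubgroup)⁻¹]
  refine Set.ncard_lt_ncard ⟨?_, fun hsub => ?_⟩ (Set.toFinite _)
  · intro p hp
    rw [Function.mem_support, h] at hp
    by_cases hp1 : p = 1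
    · exact hp1 ▸ h1
    by_cases hps : p = s
    · exact hps ▸ h2
    rwa [pointChain_of_ne hp1, pointChain_of_ne hps, add_zero, add_zero] at hp
  · have := hsub h1
    rw [Function.mem_support, h, pointChain_self, pointChain_of_ne hs1.symm, add_zero,
      zmod_two_eq_one h1] at this
    exact this (CharTwo.add_self_eq_zero (1 : ZMod 2))

lemma ncard_support_pathChain_inv_mul_eq {i j : Bool} (hij : i ≠ j) {s g : Coprod A B}
    (hs : s ∈ factor A B j) :
    (Function.support (pathChain M i (s⁻¹ * g))).ncard =
      (Function.support (pathChain M i g)).ncard := by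
  rw [← ncard_support_translate (pathChain M i g) (s : _ ⧸ M.toSubgroup)]
  congr 2
  ext p
  rw [pathChain_mul, pathChain_other M hij (inv_mem hs), zero_add, QuotientGroup.mk_inv, inv_inv]

/-- Elements of small energy are, up to the mod 2 homology cover, in a finite set which does not
depend on the finite quotient, if this has large girth. -/
lemma IsCutFamily.exists_finset_of_ncard_le (hF : IsCutFamily F) (m : ℕ) : ∀ C : ℝ,
    ∃ (E T : Finset (Coprod A B)) (n₀ : ℕ), (∀ t ∈ T, t ≠ 1 ∧ ∃ i, t ∈ factor A B i) ∧
      ∀ (M : FiniteIndexNormalSubgroup (Coprod A B)) (n : ℕ), n₀ ≤ n → (∀ t ∈ T, t ∉ M) →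
        HasGirth M m → ∀ g, ∑ i, (Function.support (pathChain M i g)).ncard ≤ m →
          energy F M n g ≤ C → ∃ e ∈ E, e⁻¹ * g ∈ homologyCover M := by
  classical
  -- The two chains together have boundary `1 + g`, so outside `M` one of them contains the edge
  -- `1`.
  have hodd : ∀ (M : FiniteIndexNormalSubgroup (Coprod A B)) g, g ∉ M →
      ∃ i, pathChain M i g 1 ≠ 0 := by
    intro M g hg
    by_contra! hcon
    have h := pathChain_add M g 1
    rw [hcon, hcon, pointChain_self, pointChain_of_ne, add_zero, add_zero] at h
    · exact zero_ne_one h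
    · exact fun h => hg ((QuotientGroup.eq_one_iff g).1 h.symm)
  -- Inside `M` both chains are the same cycle, which is shorter than the girth and hence zero.
  have hone : ∀ (M : FiniteIndexNormalSubgroup (Coprod A B)) m g, g ∈ M → HasGirth M m →
      ∑ i, (Function.support (pathChain M i g)).ncard ≤ m → g ∈ homologyCover M := by
    intro M m g hg hM hm
    refine (mem_homologyCover M).2 ⟨hg, fun i p => ?_⟩
    have hi : ∀ j, pathChain M j g = pathChain M i g := fun j => funext fun p =>
      (pathChain_of_mem M hg j p).trans (pathChain_of_mem M hg i p).symm
    refine congrFun (hM.eq_zero_of_isEven M (fun j => hi j ▸ isEven_pathChain M j g) ?_) p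
    exact (Finset.single_le_sum (f := fun i => (Function.support (pathChain M i g)).ncard)
      (fun _ _ => Nat.zero_le _) (Finset.mem_univ i)).trans hm
  induction m with
  | zero =>
    refine fun C => ⟨{1}, ∅, 0, by simp, fun M n _ _ hM g hm _ => ⟨1, by simp, ?_⟩⟩
    rw [inv_one, one_mul]
    refine hone M 0 g ?_ hM hm
    by_contra hg
    obtain ⟨i, hi⟩ := hodd M g hg
    have h0 := Finset.sum_eq_zero_iff.1 (Nat.le_zero.1 hm) i (Finset.mem_univ i)
    rw [Set.ncard_eq_zero] at h0
    exact (h0 ▸ (show (1 : Coprod A B ⧸ M.toSubgroup) ∈ Function.support _ from hi)).elim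
  | succ m ih =>
    intro C
    obtain ⟨K, hK⟩ := exists_nat_gt C
    -- The candidates for the second edge: nontrivial quotients of two elements of one of the first
    -- `K` Følner sets.
    let U : Finset (Coprod A B) := (Finset.univ.biUnion fun i => (Finset.range K).biUnion fun k =>
      Finset.image₂ (fun f f' => f⁻¹ * f') (F i k) (F i k)) \ {1}
    have hU : ∀ i, ∀ k < K, ∀ f ∈ F i k, ∀ f' ∈ F i k, f ≠ f' → f⁻¹ * f' ∈ U := by
      intro i k hk f hf f' hf' hne
      simp only [U, Finset.mem_sdiff, Finset.mem_biUnion, Finset.mem_singleton, inv_mul_eq_one]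
      exact ⟨⟨i, Finset.mem_univ _, k, Finset.mem_range.2 hk, Finset.mem_image₂_of_mem hf hf'⟩, hne⟩
    choose c hc using hF.exists_energy_le
    -- Removing a letter `u` may increase the energy by `c u⁻¹`; the sum covers all candidates at
    -- once.
    obtain ⟨E, T, n₀, hT, hE⟩ := ih (∑ u ∈ U, |c u⁻¹| + C)
    refine ⟨insert 1 (Finset.image₂ (· * ·) U E), T ∪ U, max n₀ K, ?_, ?_⟩
    · intro t ht
      rcases Finset.mem_union.1 ht with ht | ht
      · exact hT t ht
      · simp only [U, Finset.mem_sdiff, Finset.mem_biUnion, Finset.mem_singleton] at ht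
        obtain ⟨⟨i, -, k, -, h⟩, h1⟩ := ht
        obtain ⟨f, hf, f', hf', rfl⟩ := Finset.mem_image₂.1 h
        exact ⟨h1, i, mul_mem (inv_mem (hF.mem_factor i k f hf)) (hF.mem_factor i k f' hf')⟩
    · intro M n hn hTM hM g hm hgC
      by_cases hg : g ∈ M
      · exact ⟨1, by simp, by simpa using hone M _ g hg hM hm⟩
      obtain ⟨i, hi⟩ := hodd M g hg
      have hUM : ∀ u ∈ U, u ∉ M := fun u hu => hTM u (Finset.mem_union_right _ hu)
      obtain ⟨k, hk, f, hf, f', hf', hne, hff⟩ := hF.exists_ne_zero_of_cutNorm_lt M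
        (le_of_max_le_right hn) hi (lt_of_le_of_lt ((Finset.single_le_sum
          (f := fun i => cutNorm F M n i (pathChain M i g))
          (fun _ _ => cutNorm_nonneg F M n _ _) (Finset.mem_univ i)).trans hgC) hK)
        fun k hk f hf f' hf' hne => hUM _ (hU i k hk f hf f' hf' hne)
      have huU := hU i k hk f hf f' hf' hne
      have hui : f⁻¹ * f' ∈ factor A B i :=
        mul_mem (inv_mem (hF.mem_factor i k f hf)) (hF.mem_factor i k f' hf')
      generalize f⁻¹ * f' = s at huU hff hui
      obtain ⟨e, he, heg⟩ := hE M n (le_of_max_le_left hn)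
        (fun t ht => hTM t (Finset.mem_union_left _ ht)) (hM.mono M (Nat.le_succ m)) (s⁻¹ * g)
        (by
          refine Nat.le_of_lt_succ (lt_of_lt_of_le (Finset.sum_lt_sum (fun j _ => ?_)
            ⟨i, Finset.mem_univ i,
              ncard_support_pathChain_inv_mul_lt M hui (hUM s huU) hi hff⟩) hm)
          rcases eq_or_ne j i with rfl | hj
          · exact (ncard_support_pathChain_inv_mul_lt M hui (hUM s huU) hi hff).le
          · exact (ncard_support_pathChain_inv_mul_eq M hj hui).le)
        ((energy_mul_le F M n _ _).trans (add_le_add (((hc s⁻¹ M n).trans (le_abs_self _)).trans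
          (Finset.single_le_sum (f := fun u => |c u⁻¹|) (fun _ _ => abs_nonneg _) huU)) hgC))
      refine ⟨s * e, Finset.mem_insert_of_mem (Finset.mem_image₂_of_mem huU he), ?_⟩
      rwa [mul_inv_rev, mul_assoc]

/-- The energy is the square of a Hilbert space metric. -/
lemma exists_sum_sq_eq_energy (n : ℕ) :
    ∃ (d : ℕ) (f : Coprod A B → Fin d → ℝ),
      ∀ x y, ∑ j, (f x j - f y j) ^ 2 = energy F M n (x⁻¹ * y) := by
  classical
  have := Fintype.ofFinite (Coprod A B ⧸ M.toSubgroup)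
  let ι := Bool × Fin n × (Coprod A B ⧸ M.toSubgroup)
  -- One coordinate for each cut: the indicator of odd parity times the square root of the weight.
  -- Two such indicators differ exactly when the mod 2 parities have sum 1.
  let f : Coprod A B → ι → ℝ := fun x j =>
    if cutParity F M j.1 j.2.1 (pathChain M j.1 x) j.2.2 ≠ 0 then √(1 / (F j.1 j.2.1).card) else 0
  let e := Fintype.equivFin ι
  refine ⟨Fintype.card ι, fun x j => f x (e.symm j), fun x y => ?_⟩
  rw [Equiv.sum_comp e.symm fun j => (f x j - f y j) ^ 2, Fintype.sum_prod_type]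
  refine Finset.sum_congr rfl fun i _ => ?_
  rw [Fintype.sum_prod_type, cutNorm, ← Fin.sum_univ_eq_sum_range fun k =>
    ((Function.support (cutParity F M i k (pathChain M i (x⁻¹ * y)))).ncard : ℝ) / (F i k).card]
  refine Finset.sum_congr rfl fun k _ => ?_
  rw [← ncard_support_translate _ (x : _ ⧸ M.toSubgroup)⁻¹, Set.ncard_eq_toFinset_card',
    Set.toFinset_card, Fintype.card_subtype, Finset.card_filter, Nat.cast_sum, Finset.sum_div]
  refine Finset.sum_congr rfl fun p _ => ?_
  have h : cutParity F M i k (pathChain M i y) p = cutParity F M i k (pathChain M i x) p +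
      cutParity F M i k (pathChain M i (x⁻¹ * y)) ((x : _ ⧸ M.toSubgroup)⁻¹ * p) := by
    conv_lhs => rw [← mul_inv_cancel_left x y, pathChain_mul_eq, cutParity_add, Pi.add_apply,
      cutParity_translate]
  simp only [f, h, Function.mem_support]
  by_cases h1 : cutParity F M i k (pathChain M i x) p = 0 <;>
  by_cases h2 : cutParity F M i k (pathChain M i (x⁻¹ * y)) ((x : _ ⧸ M.toSubgroup)⁻¹ * p) = 0
  · simp [h1, h2]
  · rw [h1, zmod_two_eq_one h2]
    simp
  · rw [h2, zmod_two_eq_one h1]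
    simp
  · rw [zmod_two_eq_one h1, zmod_two_eq_one h2, CharTwo.add_self_eq_zero]
    simp

end Cuts

/-! ## Følner sets -/

section Folner

lemma hasSum_norm_sq {ι : Type*} (ξ : lp (fun _ : ι => ℂ) 2) :
    HasSum (fun x => ‖ξ x‖ ^ 2) (‖ξ‖ ^ 2) := by
  have h := lp.hasSum_norm (p := 2) (by norm_num) ξ
  simpa using h

variable {A : Type u} [Group A]

lemma hasSum_norm_leftRegular_sub_sq (g : A) (ξ : lp (fun _ : A => ℂ) 2) :
    HasSum (fun x => ‖ξ (g⁻¹ * x) - ξ x‖ ^ 2) (‖leftRegular g ξ - ξ‖ ^ 2) :=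
  hasSum_norm_sq (leftRegular g ξ - ξ)

/-- A weighted arithmetic-geometric mean bound for `‖a - b‖ * (‖a‖ + ‖b‖)`, which replaces
Cauchy-Schwarz by an estimate that can be summed termwise. -/
lemma abs_norm_sq_sub_norm_sq_le {E : Type*} [SeminormedAddCommGroup E] (a b : E) {δ : ℝ}
    (hδ : 0 < δ) :
    |‖a‖ ^ 2 - ‖b‖ ^ 2| ≤ δ⁻¹ * ‖a - b‖ ^ 2 + δ * (‖a‖ ^ 2 + ‖b‖ ^ 2) := by
  have h1 : |‖a‖ ^ 2 - ‖b‖ ^ 2| ≤ ‖a - b‖ * (‖a‖ + ‖b‖) := by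
    rw [sq_sub_sq, abs_mul, abs_of_nonneg (by positivity : 0 ≤ ‖a‖ + ‖b‖), mul_comm]
    exact mul_le_mul_of_nonneg_right (abs_norm_sub_norm_le a b) (by positivity)
  refine h1.trans ?_
  have h2 : δ⁻¹ * ‖a - b‖ ^ 2 + δ * (‖a‖ ^ 2 + ‖b‖ ^ 2) - ‖a - b‖ * (‖a‖ + ‖b‖) =
      δ⁻¹ * (‖a - b‖ - δ / 2 * (‖a‖ + ‖b‖)) ^ 2 + δ / 4 * ((‖a‖ + ‖b‖) ^ 2
        + 2 * (‖a‖ - ‖b‖) ^ 2) := by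
    field_simp
    ring
  have h3 : 0 ≤ δ⁻¹ * (‖a - b‖ - δ / 2 * (‖a‖ + ‖b‖)) ^ 2 + δ / 4 * ((‖a‖ + ‖b‖) ^ 2
        + 2 * (‖a‖ - ‖b‖) ^ 2) := by positivity
  linarith

lemma tsum_ofReal_abs_norm_sq_sub_le {ξ : lp (fun _ : A => ℂ) 2} (hξ : ‖ξ‖ = 1) {g : A} {δ : ℝ}
    (hδ : 0 < δ) (hg : ‖leftRegular g ξ - ξ‖ ≤ δ) :
    ∑' x, ENNReal.ofReal |‖ξ (g⁻¹ * x)‖ ^ 2 - ‖ξ x‖ ^ 2| ≤ ENNReal.ofReal (3 * δ) := by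
  have hsum : HasSum (fun x => ‖ξ x‖ ^ 2) 1 := by
    have := hasSum_norm_sq ξ
    rwa [hξ, one_pow] at this
  have h1 := hasSum_norm_leftRegular_sub_sq g ξ
  have h2 : HasSum (fun x => ‖ξ (g⁻¹ * x)‖ ^ 2) 1 := (Equiv.mulLeft g⁻¹).hasSum_iff.2 hsum
  have h3 := (h1.mul_left δ⁻¹).add ((h2.add hsum).mul_left δ)
  have h4 : ∀ x, |‖ξ (g⁻¹ * x)‖ ^ 2 - ‖ξ x‖ ^ 2| ≤ δ⁻¹ * ‖ξ (g⁻¹ * x) - ξ x‖ ^ 2 +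
    δ * (‖ξ (g⁻¹ * x)‖ ^ 2 + ‖ξ x‖ ^ 2) := fun x => abs_norm_sq_sub_norm_sq_le _ _ hδ
  have h5 := Summable.of_nonneg_of_le (fun x => abs_nonneg _) h4 h3.summable
  rw [← ENNReal.ofReal_tsum_of_nonneg (fun x => abs_nonneg _) h5]
  refine ENNReal.ofReal_le_ofReal ((h5.tsum_le_tsum h4 h3.summable).trans
    (h3.tsum_eq.le.trans ?_))
  -- The constant is `δ⁻¹ * δ ^ 2 + 2 * δ = 3 * δ`, as both squared norms sum to 1.
  have h6 : δ⁻¹ * ‖leftRegular g ξ - ξ‖ ^ 2 ≤ δ⁻¹ * δ ^ 2 := by gcongr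
  have h7 : δ⁻¹ * δ ^ 2 = δ := by field_simp
  linarith

/-- Namioka's trick: the density `‖ξ‖²` is almost invariant in `ℓ¹`, and by the layer cake formula
one of its level sets must be almost invariant. -/
lemma IsAmenable.exists_finset_symmDiff_le (hA : IsAmenable A) [Countable A] (E : Finset A) {ε : ℝ}
    (hε : 0 < ε) : open scoped Classical in ∃ F : Finset A, F.Nonempty ∧
      ∀ g ∈ E, ((symmDiff F (F.image (g * ·))).card : ℝ) ≤ ε * F.card := by
  classical
  by_contra! hcon
  set δ : ℝ := ε / (4 * (E.card + 1)) with hδ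
  have hδ0 : 0 < δ := by positivity
  obtain ⟨ξ, hξ, hinv⟩ := hA E δ hδ0
  have hsum : HasSum (fun x => ‖ξ x‖ ^ 2) 1 := by
    have := hasSum_norm_sq ξ
    rwa [hξ, one_pow] at this
  -- the level sets of `‖ξ‖²` are integrated over all heights
  let I : A → ℝ → ℝ≥0∞ := fun x => (Set.Ioc 0 (‖ξ x‖ ^ 2)).indicator 1
  let J : A → A → ℝ → ℝ≥0∞ := fun g x =>
    (Set.Ioc (min (‖ξ x‖ ^ 2) (‖ξ (g⁻¹ * x)‖ ^ 2)) (max (‖ξ x‖ ^ 2) (‖ξ (g⁻¹ * x)‖ ^ 2))).indicator 1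
  have hI : ∀ x, ∫⁻ t, I x t = ENNReal.ofReal (‖ξ x‖ ^ 2) := fun x => by
    simp only [I]
    rw [MeasureTheory.lintegral_indicator_one measurableSet_Ioc, Real.volume_Ioc, sub_zero]
  have hJ : ∀ g x, ∫⁻ t, J g x t = ENNReal.ofReal |‖ξ (g⁻¹ * x)‖ ^ 2 - ‖ξ x‖ ^ 2| := fun g x => by
    simp only [J]
    rw [MeasureTheory.lintegral_indicator_one measurableSet_Ioc, Real.volume_Ioc,
      max_sub_min_eq_abs]
  -- If no level set were Følner, some `g ∈ E` would fail at each height with a nonempty level set.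
  -- Integrated over `t` this gives `ε ≤ E.card * (3 * δ)`, against the choice of `δ`.
  have hpt : ∀ t, ENNReal.ofReal ε * ∑' x, I x t ≤ ∑ g ∈ E, ∑' x, J g x t := by
    intro t
    rcases le_or_gt t 0 with ht | ht
    · have : ∀ x, I x t = 0 := fun x => by simp [I, ht]
      simp [this]
    have hfin : {x | t ≤ ‖ξ x‖ ^ 2}.Finite := by
      have := hsum.summable.tendsto_cofinite_zero.eventually_lt_const ht
      simpa [Filter.eventually_cofinite, not_lt] using this
    set F := hfin.toFinset with hF
    have hmem : ∀ x, x ∈ F ↔ t ≤ ‖ξ x‖ ^ 2 := fun x => by simp [hF]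
    have hIF : ∑' x, I x t = F.card := by
      rw [tsum_eq_sum (s := F)]
      · rw [Finset.sum_congr rfl (g := fun _ => 1) fun x hx => ?_]
        · simp
        · simp [I, ht, (hmem x).1 hx]
      · intro x hx
        rw [hmem] at hx
        simp [I, hx]
    rcases F.eq_empty_or_nonempty with h0 | hne
    · simp [hIF, h0]
    obtain ⟨g, hg, hlt⟩ := hcon F hne
    have hJF : ∑' x, J g x t = (symmDiff F (F.image (g * ·))).card := by
      have hmem' : ∀ x, x ∈ symmDiff F (F.image (g * ·)) ↔
          t ∈ Set.Ioc (min (‖ξ x‖ ^ 2) (‖ξ (g⁻¹ * x)‖ ^ 2))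
            (max (‖ξ x‖ ^ 2) (‖ξ (g⁻¹ * x)‖ ^ 2)) := by
        intro x
        have : x ∈ F.image (g * ·) ↔ t ≤ ‖ξ (g⁻¹ * x)‖ ^ 2 := by
          rw [← hmem]
          simp
        rw [Finset.mem_symmDiff, this, hmem, Set.mem_Ioc, min_lt_iff, le_max_iff, not_le, not_le]
        constructor
        · tauto
        · rintro ⟨h1 | h1, h2 | h2⟩
          · exact absurd h2 h1.not_ge
          · exact Or.inr ⟨h2, h1⟩
          · exact Or.inl ⟨h2, h1⟩
          · exact absurd h2 h1.not_ge
      rw [tsum_eq_sum (s := symmDiff F (F.image (g * ·)))]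
      · rw [Finset.sum_congr rfl (g := fun _ => 1) fun x hx => ?_]
        · simp
        · simp only [J]
          rw [Set.indicator_of_mem ((hmem' x).1 hx), Pi.one_apply]
      · intro x hx
        simp only [J]
        rw [Set.indicator_of_notMem (mt (hmem' x).2 hx)]
    refine le_trans ?_ (Finset.single_le_sum (f := fun g => ∑' x, J g x t)
      (fun _ _ => zero_le) hg)
    rw [hIF, hJF, ← ENNReal.ofReal_natCast, ← ENNReal.ofReal_natCast,
      ← ENNReal.ofReal_mul hε.le]
    exact ENNReal.ofReal_le_ofReal hlt.le
  have hImeas : ∀ x, Measurable (I x) := fun x => measurable_one.indicator measurableSet_Ioc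
  have hJmeas : ∀ g x, Measurable (J g x) := fun g x => measurable_one.indicator measurableSet_Ioc
  have hint := MeasureTheory.lintegral_mono (μ := MeasureTheory.volume) hpt
  rw [MeasureTheory.lintegral_const_mul _ (Measurable.tsum hImeas),
    MeasureTheory.lintegral_tsum fun x => (hImeas x).aemeasurable,
    MeasureTheory.lintegral_finsetSum _ fun g _ => Measurable.tsum (hJmeas g)] at hint
  simp only [MeasureTheory.lintegral_tsum fun x => (hJmeas _ x).aemeasurable, hI, hJ] at hint
  rw [← ENNReal.ofReal_tsum_of_nonneg (fun x => by positivity) hsum.summable, hsum.tsum_eq,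
    ENNReal.ofReal_one, mul_one] at hint
  have hE : ∀ g ∈ E, ∑' x, ENNReal.ofReal |‖ξ (g⁻¹ * x)‖ ^ 2 - ‖ξ x‖ ^ 2| ≤
      ENNReal.ofReal (3 * δ) := fun g hg =>
    tsum_ofReal_abs_norm_sq_sub_le hξ hδ0 (hinv g hg)
  have hfinal := hint.trans (Finset.sum_le_sum hE)
  rw [Finset.sum_const, nsmul_eq_mul, ← ENNReal.ofReal_natCast, ← ENNReal.ofReal_mul (by positivity),
    ENNReal.ofReal_le_ofReal_iff (by positivity)] at hfinal
  have : (E.card : ℝ) * (3 * δ) < ε := by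
    rw [hδ, mul_div_assoc', mul_div_assoc', div_lt_iff₀ (by positivity)]
    have : (0 : ℝ) ≤ E.card := by positivity
    nlinarith
  linarith

lemma IsAmenable.exists_folner_sequence (hA : IsAmenable A) [Countable A] :
    open scoped Classical in ∃ F : ℕ → Finset A, F 0 = {1} ∧ (∀ k, (F k).Nonempty) ∧
      ∀ s : A, ∃ C : ℝ, ∀ n, ∑ k ∈ Finset.range n,
        ((symmDiff (F k) ((F k).image (· * s⁻¹))).card : ℝ) / (F k).card ≤ C := by
  classical
  obtain ⟨e, he⟩ := exists_surjective_nat A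
  choose F hne hF using fun k : ℕ => hA.exists_finset_symmDiff_le
    ((Finset.range k).image e) (ε := (1 / 2) ^ k) (by positivity)
  -- Inversion turns left almost invariance into right almost invariance.
  let F' : ℕ → Finset A := fun k => if k = 0 then {1} else (F k).image (·⁻¹)
  have hne' : ∀ k, (F' k).Nonempty := fun k => by
    simp only [F']
    split_ifs
    · simp
    · exact (hne k).image _
  refine ⟨F', rfl, hne', fun s => ?_⟩
  obtain ⟨j, rfl⟩ := he s
  have hle2 : ∀ k, ((symmDiff (F' k) ((F' k).image (· * (e j)⁻¹))).card : ℝ) / (F' k).card ≤ 2 := by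
    intro k
    rw [div_le_iff₀ (by exact_mod_cast (hne' k).card_pos)]
    have h1 : (symmDiff (F' k) ((F' k).image (· * (e j)⁻¹))).card ≤
        (F' k).card + ((F' k).image (· * (e j)⁻¹)).card :=
      (Finset.card_le_card symmDiff_le_sup).trans (Finset.card_union_le _ _)
    have h2 : ((F' k).image (· * (e j)⁻¹)).card ≤ (F' k).card := Finset.card_image_le
    exact_mod_cast (by lia : _ ≤ 2 * (F' k).card)
  have hle : ∀ k, j < k →
      ((symmDiff (F' k) ((F' k).image (· * (e j)⁻¹))).card : ℝ) / (F' k).card ≤ (1 / 2) ^ k := by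
    intro k hk
    rw [div_le_iff₀ (by exact_mod_cast (hne' k).card_pos)]
    have h0 : F' k = (F k).image (·⁻¹) := if_neg (by lia)
    have h1 : (F' k).image (· * (e j)⁻¹) = ((F k).image (e j * ·)).image (·⁻¹) := by
      simp only [h0, Finset.image_image, Function.comp_def, mul_inv_rev]
    rw [h1, h0, ← Finset.image_symmDiff _ _ inv_injective,
      Finset.card_image_of_injective _ inv_injective, Finset.card_image_of_injective _ inv_injective]
    exact hF k _ (Finset.mem_image_of_mem e (Finset.mem_range.2 hk))
  -- The trivial ratio bound 2 serves the indices up to `j`, where `e j` is not yet controlled; the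
  -- rest is a geometric series.
  refine ⟨2 * (j + 1) + 2, fun n => ?_⟩
  calc _ ≤ ∑ k ∈ Finset.range n, ((if k < j + 1 then (2 : ℝ) else 0) + (1 / 2) ^ k) := by
        refine Finset.sum_le_sum fun k _ => ?_
        split_ifs with h
        · exact (hle2 k).trans (by simp)
        · exact (hle k (by lia)).trans (by simp)
    _ ≤ _ := by
        rw [Finset.sum_add_distrib]
        refine add_le_add ?_ (sum_geometric_two_le n)
        rw [← Finset.sum_filter, Finset.sum_const, nsmul_eq_mul, mul_comm]
        have : ((Finset.range n).filter (· < j + 1)).card ≤ j + 1 := by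
          conv_rhs => rw [← Finset.card_range (j + 1)]
          exact Finset.card_le_card fun k hk => Finset.mem_range.2 (Finset.mem_filter.1 hk).2
        gcongr
        exact_mod_cast this

lemma countable_of_fg [Group.FG A] : Countable A := by
  obtain ⟨S, hS, φ, hφ⟩ := Group.fg_iff_exists_freeGroup_hom_surjective.1 ‹Group.FG A›
  have : Finite S := hS
  have : Countable (FreeGroup S) :=
    (Quot.mk_surjective : Function.Surjective (FreeGroup.mk (α := S))).countable
  exact hφ.countable

end Folner

/-! ### The tower of covers and the sequence of subgroups -/

section Sequence

variable {A : Type u} {B : Type v} [Group A] [Group B]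

lemma exists_isCutFamily [Countable A] [Countable B] (hA : IsAmenable A) (hB : IsAmenable B) :
    ∃ F : Bool → ℕ → Finset (Coprod A B), IsCutFamily F := by
  classical
  obtain ⟨F, hF0, hFne, hF⟩ := hA.exists_folner_sequence
  obtain ⟨F', hF0', hFne', hF'⟩ := hB.exists_folner_sequence
  refine ⟨fun i k => if i then (F k).image Coprod.inl else (F' k).image Coprod.inr,
    ⟨?_, ?_, ?_, ?_⟩⟩
  · rintro (_ | _) k s hs
    · obtain ⟨b, -, rfl⟩ := Finset.mem_image.1 hs
      exact inr_mem_factor b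
    · obtain ⟨a, -, rfl⟩ := Finset.mem_image.1 hs
      exact inl_mem_factor a
  · rintro (_ | _)
    · simp [hF0']
    · simp [hF0]
  · rintro (_ | _) k
    · exact (hFne' k).image _
    · exact (hFne k).image _
  · rintro (_ | _) _ ⟨s, rfl⟩
    · obtain ⟨C, hC⟩ := hF' s
      refine ⟨C, fun n => le_trans (le_of_eq ?_) (hC n)⟩
      refine Finset.sum_congr rfl fun k _ => ?_
      have h1 : ((F' k).image Coprod.inr).image (· * (Coprod.inr s : Coprod A B)⁻¹) =
          ((F' k).image (· * s⁻¹)).image Coprod.inr := by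
        simp only [Finset.image_image, Function.comp_def, map_mul, map_inv]
      simp only [Bool.false_eq_true, if_false]
      rw [h1, ← Finset.image_symmDiff _ _ Coprod.inr_injective,
        Finset.card_image_of_injective _ Coprod.inr_injective,
        Finset.card_image_of_injective _ Coprod.inr_injective]
    · obtain ⟨C, hC⟩ := hF s
      refine ⟨C, fun n => le_trans (le_of_eq ?_) (hC n)⟩
      refine Finset.sum_congr rfl fun k _ => ?_
      have h1 : ((F k).image Coprod.inl).image (· * (Coprod.inl s : Coprod A B)⁻¹) =
          ((F k).image (· * s⁻¹)).image Coprod.inl := by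
        simp only [Finset.image_image, Function.comp_def, map_mul, map_inv]
      simp only [if_true]
      rw [h1, ← Finset.image_symmDiff _ _ Coprod.inl_injective,
        Finset.card_image_of_injective _ Coprod.inl_injective,
        Finset.card_image_of_injective _ Coprod.inl_injective]

/-- The iterated mod 2 homology cover. -/
def iteratedCover (M : FiniteIndexNormalSubgroup (Coprod A B)) (n : ℕ) :
    FiniteIndexNormalSubgroup (Coprod A B) :=
  homologyCover^[n] M

lemma iteratedCover_succ (M : FiniteIndexNormalSubgroup (Coprod A B)) (n : ℕ) :
    iteratedCover M (n + 1) = homologyCover (iteratedCover M n) :=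
  Function.iterate_succ_apply' _ _ _

lemma iteratedCover_le (M : FiniteIndexNormalSubgroup (Coprod A B)) (n : ℕ) :
    iteratedCover M n ≤ M := by
  induction n with
  | zero => exact le_rfl
  | succ n ih => exact (iteratedCover_succ M n).le.trans ((homologyCover_le _).trans ih)

lemma hasGirth_iteratedCover (M : FiniteIndexNormalSubgroup (Coprod A B)) (n : ℕ) :
    HasGirth (iteratedCover M n) n := by
  induction n with
  | zero => exact hasGirth_zero _
  | succ n ih => exact iteratedCover_succ M n ▸ ih.homologyCover

lemma exists_notMem_of_mem_factor [Group.ResiduallyFinite A] [Group.ResiduallyFinite B]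
    {i : Bool} {t : Coprod A B} (ht : t ∈ factor A B i) (h1 : t ≠ 1) :
    ∃ M : FiniteIndexNormalSubgroup (Coprod A B), t ∉ M := by
  cases i
  · obtain ⟨b, rfl⟩ := ht
    obtain ⟨K, hK⟩ := Group.exists_finiteIndexNormalSubgroup_notMem b
      (by rintro rfl; exact h1 (map_one _))
    exact ⟨K.comap Coprod.snd, hK⟩
  · obtain ⟨a, rfl⟩ := ht
    obtain ⟨K, hK⟩ := Group.exists_finiteIndexNormalSubgroup_notMem a
      (by rintro rfl; exact h1 (map_one _))
    exact ⟨K.comap Coprod.fst, hK⟩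

/-- There is a sequence of finite-index normal subgroups which eventually avoids each nontrivial
element of the factors. -/
lemma exists_sequence_avoiding [Countable A] [Countable B]
    [Group.ResiduallyFinite A] [Group.ResiduallyFinite B] :
    ∃ M : ℕ → FiniteIndexNormalSubgroup (Coprod A B),
      ∀ i, ∀ t ∈ factor A B i, t ≠ 1 → ∀ᶠ n in Filter.atTop, t ∉ M n := by
  classical
  have hcount : Countable (Coprod A B) :=
    have : Countable (FreeMonoid (A ⊕ B)) := inferInstanceAs (Countable (List _))
    Coprod.mk_surjective.countable
  have hL : ∀ t : Coprod A B, ∃ L : FiniteIndexNormalSubgroup (Coprod A B),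
      ∀ i, t ∈ factor A B i → t ≠ 1 → t ∉ L := by
    intro t
    by_cases h : ∃ i, t ∈ factor A B i ∧ t ≠ 1
    · obtain ⟨i, hi, h1⟩ := h
      obtain ⟨L, hL⟩ := exists_notMem_of_mem_factor hi h1
      exact ⟨L, fun _ _ _ => hL⟩
    · exact ⟨.ofSubgroup ⊤, fun i hi h1 => absurd ⟨i, hi, h1⟩ h⟩
  choose L hL using hL
  obtain ⟨e, he⟩ := exists_surjective_nat (Coprod A B)
  refine ⟨fun n => (Finset.range (n + 1)).inf' (by simp) fun j => L (e j), fun i t ht h1 => ?_⟩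
  obtain ⟨j, rfl⟩ := he t
  filter_upwards [Filter.eventually_ge_atTop j] with n hn hmem
  exact hL _ i ht h1 (Finset.inf'_le (f := fun j => L (e j))
    (Finset.mem_range.2 (Nat.lt_succ_of_le hn)) hmem)

/-- Every element of `A ∗ B` is the product of an alternating word. -/
lemma exists_isAlternating (g : Coprod A B) :
    ∃ w : List (Bool × Coprod A B), IsAlternating ⊥ w ∧ wordProd w = g := by
  induction g using factor_induction with
  | one => exact ⟨[], ⟨by simp, by simp⟩, rfl⟩
  | mul i s hs g ih =>
    obtain ⟨w, hw, rfl⟩ := ih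
    by_cases hs1 : s = 1
    · exact ⟨w, hw, by rw [hs1, one_mul]⟩
    cases w with
    | nil => exact ⟨[(i, s)], ⟨by simp, by simpa using ⟨hs, hs1⟩⟩, by simp [wordProd]⟩
    | cons x t =>
      have ht : IsAlternating ⊥ t := hw.infix (List.suffix_cons x t).isInfix
      have hx := hw.2 x (by simp)
      have hc := List.isChain_cons.1 hw.1
      rcases eq_or_ne i x.1 with rfl | hi
      · by_cases hsx : s * x.2 = 1
        · exact ⟨t, ht, by rw [wordProd_cons, ← mul_assoc, hsx, one_mul]⟩
        · refine ⟨(x.1, s * x.2) :: t, ⟨List.isChain_cons.2 ⟨hc.1, hc.2⟩, ?_⟩, ?_⟩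
          · intro y hy
            rcases List.mem_cons.1 hy with rfl | hy
            · exact ⟨mul_mem hs hx.1, hsx⟩
            · exact ht.2 y hy
          · rw [wordProd_cons, wordProd_cons, mul_assoc]
      · refine ⟨(i, s) :: x :: t, ⟨List.isChain_cons_cons.2 ⟨hi, hw.1⟩, ?_⟩, wordProd_cons _ _⟩
        intro y hy
        rcases List.mem_cons.1 hy with rfl | hy
        · exact ⟨hs, hs1⟩
        · exact hw.2 y hy

/-- Eventually none of the finitely many letters lies in `M n`, and the girth of the `n`-th tower is
at least the length of the word. -/
lemma eventually_wordProd_notMem {M : ℕ → FiniteIndexNormalSubgroup (Coprod A B)}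
    (hM : ∀ i, ∀ t ∈ factor A B i, t ≠ 1 → ∀ᶠ n in Filter.atTop, t ∉ M n)
    {w : List (Bool × Coprod A B)} (hw : IsAlternating ⊥ w) (hne : w ≠ []) :
    ∀ᶠ n in Filter.atTop, wordProd w ∉ iteratedCover (M n) n := by
  classical
  have h : ∀ᶠ n in Filter.atTop, ∀ x ∈ w.toFinset, x.2 ∉ M n := by
    rw [Filter.eventually_all_finset]
    exact fun x hx => hM _ _ (hw.2 x (List.mem_toFinset.1 hx)).1 (hw.2 x (List.mem_toFinset.1 hx)).2
  filter_upwards [h, Filter.eventually_ge_atTop w.length] with n hn hlen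
  exact hasGirth_iteratedCover (M n) n w ⟨hw.1, fun x hx => ⟨(hw.2 x hx).1, fun hmem =>
    hn x (List.mem_toFinset.2 hx) (iteratedCover_le (M n) n hmem)⟩⟩ hne hlen

end Sequence

/-- The quotients by the subgroups `N n` have invariant Hilbert space metrics `√(D n)` which are
uniformly bounded on each group element and uniformly proper. -/
def IsUniformlyHilbertian {G : Type*} [Group G] (N : ℕ → FiniteIndexNormalSubgroup G) : Prop :=
  ∃ D : ℕ → G → ℝ, (∀ g, ∃ C, ∀ n, D n g ≤ C) ∧
    (∀ C, ∃ E : Finset G, ∀ᶠ n in Filter.atTop, ∀ g, D n g ≤ C → ∃ e ∈ E, e⁻¹ * g ∈ N n) ∧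
    (∀ n g, ∀ h ∈ N n, D n (g * h) = D n g) ∧
    ∀ n, ∃ (d : ℕ) (f : G → Fin d → ℝ), ∀ x y, ∑ j, (f x j - f y j) ^ 2 = D n (x⁻¹ * y)

section Sequence

variable {A : Type u} {B : Type v} [Group A] [Group B]

lemma exists_isUniformlyHilbertian [Countable A] [Countable B]
    [Group.ResiduallyFinite A] [Group.ResiduallyFinite B]
    (hA : IsAmenable A) (hB : IsAmenable B) :
    ∃ N : ℕ → FiniteIndexNormalSubgroup (Coprod A B),
      (∀ w : List (Bool × Coprod A B), IsAlternating ⊥ w → w ≠ [] →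
        ∀ᶠ n in Filter.atTop, wordProd w ∉ N n) ∧ IsUniformlyHilbertian N := by
  obtain ⟨F, hF⟩ := exists_isCutFamily hA hB
  obtain ⟨M, hM⟩ := exists_sequence_avoiding (A := A) (B := B)
  -- One more cover is taken because the energy over `iteratedCover (M n) n` is invariant under the
  -- homology cover of that group.
  refine ⟨fun n => homologyCover (iteratedCover (M n) n), fun w hw hne => ?_,
    fun n => energy F (iteratedCover (M n) n) n, fun g => ?_, fun C => ?_,
    fun n g h hh => energy_mul_of_mem F _ n g hh, fun n => exists_sum_sq_eq_energy _ n⟩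
  · exact (eventually_wordProd_notMem hM hw hne).mono fun n hn h => hn (homologyCover_le _ h)
  · obtain ⟨C, hC⟩ := hF.exists_energy_le g
    exact ⟨C, fun n => hC _ n⟩
  · obtain ⟨m, hm⟩ := exists_nat_ge C
    obtain ⟨E, T, n₀, hT, hE⟩ := hF.exists_finset_of_ncard_le m C
    have hTM : ∀ᶠ n in Filter.atTop, ∀ t ∈ T, t ∉ M n := by
      rw [Filter.eventually_all_finset]
      exact fun t ht => hM _ t (hT t ht).2.choose_spec (hT t ht).1
    refine ⟨E, ?_⟩
    filter_upwards [hTM, Filter.eventually_ge_atTop n₀, Filter.eventually_ge_atTop 1,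
      Filter.eventually_ge_atTop m] with n h1 h2 h3 h4 g hg
    refine hE _ n h2 (fun t ht h => h1 t ht (iteratedCover_le _ _ h))
      ((hasGirth_iteratedCover _ n).mono _ h4) g ?_ hg
    have : ((∑ i, (Function.support (pathChain (iteratedCover (M n) n) i g)).ncard : ℕ) : ℝ) ≤ m := by
      rw [Nat.cast_sum]
      exact (Finset.sum_le_sum fun i _ => hF.ncard_support_le _ h3 i _).trans (hg.trans hm)
    exact_mod_cast this

end Sequence

/-! ## Coarse embeddings from qualitative estimates -/

/-- The control functions are the lower and upper envelopes of the distances in the image. Inserting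
`t` keeps the sets nonempty when no pair of points qualifies and makes the upper envelope unbounded.
-/
lemma coarselyEmbeds_of_forall_exists {X Y : Type*} [MetricSpace X] [MetricSpace Y] (F : X → Y)
    (hup : ∀ R : ℝ, ∃ C : ℝ, ∀ x y, dist x y ≤ R → dist (F x) (F y) ≤ C)
    (hlow : ∀ C : ℝ, ∃ R : ℝ, ∀ x y, dist (F x) (F y) ≤ C → dist x y ≤ R) :
    CoarselyEmbeds X Y := by
  let L : ℝ≥0 → Set ℝ≥0 := fun t =>
    insert t {s | ∃ x y, t ≤ nndist x y ∧ nndist (F x) (F y) = s}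
  let U : ℝ≥0 → Set ℝ≥0 := fun t =>
    insert t {s | ∃ x y, nndist x y ≤ t ∧ nndist (F x) (F y) = s}
  have hU : ∀ t, BddAbove (U t) := by
    intro t
    obtain ⟨C, hC⟩ := hup t
    refine ⟨max t C.toNNReal, ?_⟩
    rintro s (rfl | ⟨x, y, hxy, rfl⟩)
    · exact le_max_left _ _
    · refine le_trans ?_ (le_max_right _ _)
      exact NNReal.le_toNNReal_of_coe_le (hC x y hxy)
  refine ⟨F, fun t => sInf (L t), fun t => sSup (U t), ⟨fun s t hst => ?_, ?_⟩,
    ⟨fun s t hst => ?_, ?_⟩, fun x y => ⟨?_, ?_⟩⟩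
  · refine le_csInf ⟨t, Set.mem_insert _ _⟩ ?_
    rintro r (rfl | ⟨x, y, hxy, rfl⟩)
    · exact (csInf_le' (Set.mem_insert _ _)).trans hst
    · exact csInf_le' (Set.mem_insert_of_mem _ ⟨x, y, hst.trans hxy, rfl⟩)
  · refine Filter.tendsto_atTop.2 fun C => ?_
    obtain ⟨R, hR⟩ := hlow C
    filter_upwards [Filter.eventually_ge_atTop C, Filter.eventually_gt_atTop R.toNNReal]
      with t hC hRt
    refine le_csInf ⟨t, Set.mem_insert _ _⟩ ?_
    rintro r (rfl | ⟨x, y, hxy, rfl⟩)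
    · exact hC
    · by_contra! hlt
      have h1 := hR x y (by exact_mod_cast hlt.le)
      have h2 : nndist x y ≤ R.toNNReal := NNReal.le_toNNReal_of_coe_le h1
      exact (h2.trans_lt hRt).not_ge hxy
  · refine csSup_le ⟨s, Set.mem_insert _ _⟩ ?_
    rintro r (rfl | ⟨x, y, hxy, rfl⟩)
    · exact hst.trans (le_csSup (hU t) (Set.mem_insert _ _))
    · exact le_csSup (hU t) (Set.mem_insert_of_mem _ ⟨x, y, hxy.trans hst, rfl⟩)
  · exact Filter.tendsto_atTop_mono (fun t => le_csSup (hU t) (Set.mem_insert _ _))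
      Filter.tendsto_id
  · exact csInf_le' (Set.mem_insert_of_mem _ ⟨x, y, le_rfl, rfl⟩)
  · exact le_csSup (hU _) (Set.mem_insert_of_mem _ ⟨x, y, le_rfl, rfl⟩)

lemma exists_lp_of_finite_support {X : Type*} (v : X → ℕ → ℝ)
    (hv : ∀ x, (Function.support (v x)).Finite) :
    ∃ F : X → lp (fun _ : ULift.{w} ℕ => ℂ) 2,
      ∀ x y, HasSum (fun k => (v x k - v y k) ^ 2) (dist (F x) (F y) ^ 2) := by
  have hmem : ∀ x, Memℓp (fun k : ULift.{w} ℕ => (v x k.down : ℂ)) 2 := by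
    intro x
    refine (memℓp_zero ?_).of_exponent_ge zero_le
    refine ((hv x).preimage (f := ULift.down.{w}) ULift.down_injective.injOn).subset fun k hk => ?_
    simpa using hk
  refine ⟨fun x => ⟨_, hmem x⟩, fun x y => ?_⟩
  rw [dist_eq_norm, ← Equiv.ulift.{w}.hasSum_iff]
  refine (hasSum_norm_sq _).congr_fun fun k => ?_
  change _ = ‖(v x k.down : ℂ) - (v y k.down : ℂ)‖ ^ 2
  rw [← Complex.ofReal_sub, Complex.norm_real, Real.norm_eq_abs, sq_abs]
  rfl

/-- Distinct powers of 2 differ by at least half the larger one, which exceeds half its exponent. So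
only components of small index can be close to one another. -/
lemma lt_of_two_mul_abs_two_pow_sub_le {a b m : ℕ} (hab : a ≠ b)
    (h : 2 * |(2 : ℝ) ^ a - 2 ^ b| ≤ m) : a < m ∧ b < m := by
  wlog hlt : a < b generalizing a b
  · rw [abs_sub_comm] at h
    exact (this hab.symm h (by lia)).symm
  have h1 : (2 : ℝ) ^ (a + 1) ≤ 2 ^ b := pow_le_pow_right₀ (by norm_num) hlt
  rw [pow_succ] at h1
  have h2 : (2 : ℝ) ^ b ≤ m := by
    have := neg_abs_le ((2 : ℝ) ^ a - 2 ^ b)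
    linarith
  have h3 : (b : ℝ) < 2 ^ b := by exact_mod_cast Nat.lt_two_pow_self
  have h4 : b < m := by exact_mod_cast h3.trans_le h2
  exact ⟨hlt.trans h4, h4⟩

/-! ## Coordinates on box spaces -/

section Coordinates

variable {G : Type*} [Group G]

/-- Coordinates on a box space: `p x` is the index of the component of `x`, and `pt n` is an
isometric parametrization of the component with index `n`. -/
structure IsBoxCoordinates (N : ℕ → FiniteIndexNormalSubgroup G) (l : GroupNorm G) {X : Type*}
    [MetricSpace X] (p : X → ℕ) (pt : ∀ n, G ⧸ (N n).toSubgroup → X) : Prop where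
  index_pt : ∀ n q, p (pt n q) = n
  exists_pt : ∀ x, ∃ q, pt (p x) q = x
  dist_pt : ∀ n q r, dist (pt n q) (pt n r) = cosetLength l (N n).toSubgroup (q⁻¹ * r)
  pt_injective : ∀ n, Function.Injective (pt n)
  index_lt : ∀ R : ℝ, ∃ m : ℕ, ∀ x y, p x ≠ p y → dist x y ≤ R → p x < m ∧ p y < m

lemma IsBoxSpace.exists_coordinates {N : ℕ → FiniteIndexNormalSubgroup G} {X : Type*}
    [MetricSpace X] (h : IsBoxSpace N X) :
    ∃ (l : GroupNorm G) (p : X → ℕ) (pt : ∀ n, G ⧸ (N n).toSubgroup → X),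
      IsProperLength l ∧ IsBoxCoordinates N l p pt := by
  obtain ⟨l, hl, p, he, ⟨ρ, hρ, hpρ⟩, -⟩ := h
  let : ∀ n, MetricSpace (G ⧸ (N n).toSubgroup) := fun n =>
    (quotientLength l (N n).toSubgroup hl).toNormedGroup.toMetricSpace
  have e : ∀ n, {x : X // p x = n} ≃ᵢ G ⧸ (N n).toSubgroup := fun n => (he n).some
  refine ⟨l, p, fun n q => (e n).symm q, hl, fun n q => ((e n).symm q).2,
    fun x => ⟨e (p x) ⟨x, rfl⟩, by rw [IsometryEquiv.symm_apply_apply]⟩, fun n q r => ?_,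
    fun n => Subtype.val_injective.comp (e n).symm.injective, fun R => ?_⟩
  · exact (e n).symm.isometry.dist_eq q r
  · obtain ⟨m, hm⟩ := exists_nat_ge (2 * (ρ R.toNNReal : ℝ))
    refine ⟨m, fun x y hxy hR => lt_of_two_mul_abs_two_pow_sub_le hxy (le_trans ?_ hm)⟩
    gcongr
    refine (hpρ x y).trans ?_
    exact_mod_cast hρ.1 (NNReal.le_toNNReal_of_coe_le hR)

variable {N : ℕ → FiniteIndexNormalSubgroup G} {l : GroupNorm G} {X : Type*} [MetricSpace X]
  {p : X → ℕ} {pt : ∀ n, G ⧸ (N n).toSubgroup → X}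

lemma IsBoxCoordinates.exists_eq_mul_of_dist_le (h : IsBoxCoordinates N l p pt)
    (hl : IsProperLength l) {n : ℕ} {q r : G ⧸ (N n).toSubgroup} {R : ℝ}
    (hR : dist (pt n q) (pt n r) ≤ R) : ∃ g : G, l g ≤ R ∧ r = q * (g : G ⧸ (N n).toSubgroup) := by
  obtain ⟨g, hg, hlg⟩ := exists_cosetLength_eq l (N n).toSubgroup hl (q⁻¹ * r)
  refine ⟨g, ?_, by rw [hg, mul_inv_cancel_left]⟩
  rwa [hlg, ← h.dist_pt]

lemma IsBoxCoordinates.dist_pt_mul_le (h : IsBoxCoordinates N l p pt) {n : ℕ}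
    (q : G ⧸ (N n).toSubgroup) (g : G) :
    dist (pt n q) (pt n (q * (g : G ⧸ (N n).toSubgroup))) ≤ l g := by
  rw [h.dist_pt, inv_mul_cancel_left]
  exact cosetLength_le _ _ _

lemma IsBoxCoordinates.finite_index_lt (h : IsBoxCoordinates N l p pt) (m : ℕ) :
    {x | p x < m}.Finite := by
  refine Set.Finite.subset (Set.Finite.biUnion (Set.finite_lt_nat m)
    fun n _ => Set.finite_range (pt n)) fun x hx => ?_
  obtain ⟨q, hq⟩ := h.exists_pt x
  exact Set.mem_biUnion (x := p x) hx ⟨q, hq⟩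

/-- Within its own component a ball is covered by the image of a ball of `G`; points of other
components have index below a bound depending on `R` alone, and these are finitely many. -/
lemma IsBoxCoordinates.boundedGeometry (h : IsBoxCoordinates N l p pt) (hl : IsProperLength l) :
    BoundedGeometry X := by
  intro R
  obtain ⟨m, hm⟩ := h.index_lt R
  refine ⟨(hl R).toFinset.card + (h.finite_index_lt m).toFinset.card, fun x => ?_⟩
  obtain ⟨q, hq⟩ := h.exists_pt x
  have hsub : Metric.closedBall x R ⊆
      (fun g : G => pt (p x) (q * (g : G ⧸ (N (p x)).toSubgroup))) '' {g | l g ≤ R} ∪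
        {y | p y < m} := by
    intro y hy
    rw [Metric.mem_closedBall, dist_comm] at hy
    by_cases hxy : p x = p y
    · obtain ⟨r, hr⟩ : ∃ r, pt (p x) r = y := hxy ▸ h.exists_pt y
      rw [← hq, ← hr] at hy
      obtain ⟨g, hg, rfl⟩ := h.exists_eq_mul_of_dist_le hl hy
      exact Or.inl ⟨g, hg, hr⟩
    · exact Or.inr (hm x y hxy hy).2
  calc (Metric.closedBall x R).encard ≤ _ := Set.encard_le_encard hsub
    _ ≤ _ := Set.encard_union_le _ _
    _ ≤ {g | l g ≤ R}.encard + {y | p y < m}.encard := by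
      gcongr
      exact Set.encard_image_le _ _
    _ = _ := by
      rw [(hl R).encard_eq_coe_toFinset_card, (h.finite_index_lt m).encard_eq_coe_toFinset_card]
      simp

lemma exists_dist_le_of_finite {X Y : Type*} [PseudoMetricSpace Y] (F : X → Y) {S : Set X}
    (hS : S.Finite) : ∃ C, ∀ x ∈ S, ∀ y ∈ S, dist (F x) (F y) ≤ C := by
  obtain ⟨C, hC⟩ := Metric.isBounded_iff.1 (hS.image F).isBounded
  exact ⟨C, fun x hx y hy => hC (Set.mem_image_of_mem F hx) (Set.mem_image_of_mem F hy)⟩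

lemma exists_forall_le_of_finite {α : Type*} (f : α → ℝ) {S : Set α} (hS : S.Finite) :
    ∃ C, ∀ x ∈ S, f x ≤ C := by
  obtain ⟨C, hC⟩ := (hS.image f).bddAbove
  exact ⟨C, fun x hx => hC (Set.mem_image_of_mem f hx)⟩

lemma exists_finite_support_hasSum {G : Type*} {d : ℕ} (f : G → Fin d → ℝ) :
    ∃ f' : G → ℕ → ℝ, (∀ x, (Function.support (f' x)).Finite) ∧
      ∀ x y, HasSum (fun j => (f' x j - f' y j) ^ 2) (∑ j, (f x j - f y j) ^ 2) := by
  refine ⟨fun x j => if h : j < d then f x ⟨j, h⟩ else 0, fun x => ?_, fun x y => ?_⟩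
  · refine (Set.finite_lt_nat d).subset fun j hj => ?_
    by_contra hjd
    simp_all
  · have := hasSum_sum_of_ne_finset_zero (s := Finset.range d) (L := .unconditional ℕ)
      (f := fun j => ((if h : j < d then f x ⟨j, h⟩ else 0) -
        (if h : j < d then f y ⟨j, h⟩ else 0)) ^ 2) fun j hj => by
        have hjd : ¬j < d := by simpa using hj
        simp [hjd]
    convert this using 1
    rw [← Fin.sum_univ_eq_sum_range fun j => ((if h : j < d then f x ⟨j, h⟩ else 0) -
        (if h : j < d then f y ⟨j, h⟩ else 0)) ^ 2]
    simp

lemma IsBoxCoordinates.exists_map_lp (h : IsBoxCoordinates N l p pt)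
    {D : ℕ → G → ℝ} (hcoset : ∀ n g, ∀ k ∈ N n, D n (g * k) = D n g)
    (hD : ∀ n, ∃ (d : ℕ) (f : G → Fin d → ℝ), ∀ x y, ∑ j, (f x j - f y j) ^ 2 = D n (x⁻¹ * y)) :
    ∃ F : X → lp (fun _ : ULift.{w} ℕ => ℂ) 2,
      (∀ n (q : G ⧸ (N n).toSubgroup) (g : G), dist (F (pt n q)) (F (pt n (q * (g : G ⧸ (N n).toSubgroup)))) ^ 2 = D n g) ∧
      ∀ x y, |(2 : ℝ) ^ p x - 2 ^ p y| ≤ dist (F x) (F y) := by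
  have hD' : ∀ n, ∃ f : G → ℕ → ℝ, (∀ x, (Function.support (f x)).Finite) ∧
      ∀ x y, HasSum (fun j => (f x j - f y j) ^ 2) (D n (x⁻¹ * y)) := by
    intro n
    obtain ⟨d, f, hf⟩ := hD n
    obtain ⟨f', hf', hs⟩ := exists_finite_support_hasSum f
    exact ⟨f', hf', fun x y => hf x y ▸ hs x y⟩
  choose f hf hs using hD'
  choose c hc using h.exists_pt
  -- Coordinate 0 separates the components; the others embed each component through coset
  -- representatives, whose choice is irrelevant for distances by `hcoset`.
  let v : X → ℕ → ℝ := fun x k => Nat.casesOn k (2 ^ p x) (f (p x) (c x).out)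
  have hv : ∀ x, (Function.support (v x)).Finite := by
    intro x
    refine (((hf (p x) (c x).out).image Nat.succ).insert 0).subset ?_
    rintro (_ | k) hk
    · exact Set.mem_insert _ _
    · exact Set.mem_insert_of_mem _ ⟨k, hk, rfl⟩
  obtain ⟨F, hF⟩ := exists_lp_of_finite_support.{w} v hv
  refine ⟨F, fun n q g => ?_, fun x y => ?_⟩
  · obtain ⟨a, ha, hva⟩ : ∃ a : G, (a : G ⧸ (N n).toSubgroup) = q ∧
        v (pt n q) = fun k => Nat.casesOn k (2 ^ n) (f n a) := by
      have h1 := hc (pt n q)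
      simp only [v]
      generalize hx : pt n q = x at *
      have hp : p x = n := hx ▸ h.index_pt n q
      subst hp
      exact ⟨(c x).out, by rw [QuotientGroup.out_eq']; exact h.pt_injective _ (h1.trans hx.symm), rfl⟩
    obtain ⟨b, hb, hvb⟩ : ∃ b : G, (b : G ⧸ (N n).toSubgroup) = q * (g : G ⧸ (N n).toSubgroup) ∧
        v (pt n (q * (g : G ⧸ (N n).toSubgroup))) = fun k => Nat.casesOn k (2 ^ n) (f n b) := by
      have h1 := hc (pt n (q * (g : G ⧸ (N n).toSubgroup)))
      simp only [v]
      generalize hx : pt n (q * (g : G ⧸ (N n).toSubgroup)) = x at *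
      have hp : p x = n := hx ▸ h.index_pt n _
      subst hp
      exact ⟨(c x).out, by rw [QuotientGroup.out_eq']; exact h.pt_injective _ (h1.trans hx.symm), rfl⟩
    have h1 := hF (pt n q) (pt n (q * (g : G ⧸ (N n).toSubgroup)))
    rw [hva, hvb] at h1
    have h2 := HasSum.zero_add (f := fun k : ℕ => ((Nat.casesOn k (2 ^ n) (f n a) : ℝ) -
      (Nat.casesOn k (2 ^ n) (f n b) : ℝ)) ^ 2) (hs n a b)
    have h3 := h1.unique h2
    rw [h3]
    have hmem : g⁻¹ * (a⁻¹ * b) ∈ N n := by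
      refine (QuotientGroup.eq_one_iff (N := (N n).toSubgroup) _).1 ?_
      rw [QuotientGroup.mk_mul, QuotientGroup.mk_mul, QuotientGroup.mk_inv, QuotientGroup.mk_inv,
        ha, hb]
      group
    have h4 := hcoset n g _ hmem
    rw [mul_inv_cancel_left] at h4
    rw [h4]
    simp
  · refine abs_le_of_sq_le_sq' ?_ dist_nonneg |> abs_le.2
    exact le_hasSum (hF x y) 0 fun _ _ => sq_nonneg _

/-- Inside a component the distances are governed by `D`, uniformly in the component for the upper
bound and from some index on for the lower one. The remaining pairs lie in a finite part of `X`. -/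
lemma IsBoxCoordinates.coarselyEmbedsIntoHilbert {X : Type w} [MetricSpace X] {p : X → ℕ}
    {pt : ∀ n, G ⧸ (N n).toSubgroup → X} (h : IsBoxCoordinates N l p pt)
    (hl : IsProperLength l) (hN : IsUniformlyHilbertian N) : CoarselyEmbedsIntoHilbert X := by
  obtain ⟨D, hbdd, hproper, hcoset, hD⟩ := hN
  obtain ⟨F, hF, hF2⟩ := h.exists_map_lp.{w} hcoset hD
  refine ⟨lp (fun _ : ULift.{w} ℕ => ℂ) 2, inferInstance, inferInstance, inferInstance,
    coarselyEmbeds_of_forall_exists F (fun R => ?_) fun C => ?_⟩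
  · obtain ⟨m, hm⟩ := h.index_lt R
    obtain ⟨C₁, hC₁⟩ := exists_dist_le_of_finite F (h.finite_index_lt m)
    choose K hK using hbdd
    obtain ⟨C₂, hC₂⟩ := exists_forall_le_of_finite K (hl R)
    refine ⟨max C₁ √C₂, fun x y hxy => ?_⟩
    by_cases hp : p x = p y
    · obtain ⟨q, hq⟩ := h.exists_pt x
      obtain ⟨r, hr⟩ : ∃ r, pt (p x) r = y := hp ▸ h.exists_pt y
      generalize p x = n at *
      subst hq hr
      obtain ⟨g, hg, rfl⟩ := h.exists_eq_mul_of_dist_le hl hxy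
      refine le_max_of_le_right (Real.le_sqrt_of_sq_le ?_)
      rw [hF]
      exact (hK g n).trans (hC₂ g hg)
    · exact le_max_of_le_left (hC₁ x (hm x y hp hxy).1 y (hm x y hp hxy).2)
  · obtain ⟨E, hE⟩ := hproper (C ^ 2)
    obtain ⟨n₀, hn₀⟩ := Filter.eventually_atTop.1 hE
    obtain ⟨m, hm⟩ := exists_nat_ge (2 * C)
    obtain ⟨R₁, hR₁⟩ := exists_dist_le_of_finite id (h.finite_index_lt (max m n₀))
    obtain ⟨R₂, hR₂⟩ := exists_forall_le_of_finite l E.finite_toSet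
    refine ⟨max R₁ R₂, fun x y hxy => ?_⟩
    by_cases hp : p x = p y
    · by_cases hx : p x < n₀
      · exact le_max_of_le_left (hR₁ x (lt_max_of_lt_right hx) y (lt_max_of_lt_right (hp ▸ hx)))
      obtain ⟨q, hq⟩ := h.exists_pt x
      obtain ⟨r, hr⟩ : ∃ r, pt (p x) r = y := hp ▸ h.exists_pt y
      generalize p x = n at *
      subst hq hr
      obtain ⟨g, hg⟩ := QuotientGroup.mk_surjective (q⁻¹ * r)
      obtain rfl : r = q * (g : G ⧸ (N n).toSubgroup) := by rw [hg, mul_inv_cancel_left]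
      obtain ⟨e, he, hge⟩ := hn₀ n (not_lt.1 hx) g (by
        rw [← hF n q g]
        gcongr)
      refine le_max_of_le_right ?_
      rw [← QuotientGroup.eq.2 hge]
      exact (h.dist_pt_mul_le q e).trans (hR₂ e he)
    · obtain ⟨h1, h2⟩ := lt_of_two_mul_abs_two_pow_sub_le hp
        ((mul_le_mul_of_nonneg_left ((hF2 x y).trans hxy) zero_le_two).trans hm)
      exact le_max_of_le_left (hR₁ x (lt_max_of_lt_left h1) y (lt_max_of_lt_left h2))

end Coordinates

/-! ## Existence of proper length functions and of box spaces -/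

section Existence

variable {G : Type u} [Group G]

/-- The word length for a finite symmetric generating set. -/
lemma exists_isProperLength [Group.FG G] : ∃ l : GroupNorm G, IsProperLength l := by
  classical
  obtain ⟨S, hS, hfin⟩ := Group.fg_iff.1 ‹Group.FG G›
  let T : Set G := S ∪ S⁻¹
  have hT : T.Finite := hfin.union hfin.inv
  have hTinv : ∀ t ∈ T, t⁻¹ ∈ T := by
    rintro t (ht | ht)
    · exact Or.inr (by simpa using ht)
    · exact Or.inl ht
  have hword : ∀ g, ∃ n, ∃ w : List G, (∀ t ∈ w, t ∈ T) ∧ w.prod = g ∧ w.length = n := by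
    intro g
    have hg : g ∈ (Subgroup.closure S).toSubmonoid := by simp [hS]
    rw [Subgroup.closure_toSubmonoid] at hg
    obtain ⟨w, hw, hwg⟩ := Submonoid.exists_list_of_mem_closure hg
    exact ⟨w.length, w, hw, hwg, rfl⟩
  let len : G → ℕ := fun g => Nat.find (hword g)
  have hle : ∀ w : List G, (∀ t ∈ w, t ∈ T) → len w.prod ≤ w.length :=
    fun w hw => Nat.find_min' (hword w.prod) ⟨w, hw, rfl, rfl⟩
  have hex : ∀ g, ∃ w : List G, (∀ t ∈ w, t ∈ T) ∧ w.prod = g ∧ w.length = len g :=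
    fun g => Nat.find_spec (hword g)
  have hinv : ∀ g, len g⁻¹ ≤ len g := by
    intro g
    obtain ⟨w, hw, rfl, hlen⟩ := hex g
    rw [← hlen, List.prod_inv_reverse]
    refine (hle _ fun t ht => ?_).trans (by simp)
    rw [List.mem_reverse, List.mem_map] at ht
    obtain ⟨s, hs, rfl⟩ := ht
    exact hTinv s (hw s hs)
  refine ⟨{ toFun := fun g => len g
            map_one' := ?_
            mul_le' := fun g h => ?_
            inv' := fun g => ?_
            eq_one_of_map_eq_zero' := fun g hg => ?_ }, fun R => ?_⟩
  · exact_mod_cast Nat.le_zero.1 (hle [] (by simp))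
  · obtain ⟨w, hw, rfl, hlen⟩ := hex g
    obtain ⟨w', hw', rfl, hlen'⟩ := hex h
    rw [← List.prod_append, ← hlen, ← hlen']
    refine (Nat.cast_le.2 (hle (w ++ w') fun t ht => ?_)).trans (by simp)
    rcases List.mem_append.1 ht with ht | ht
    exacts [hw t ht, hw' t ht]
  · have := hinv g⁻¹
    rw [inv_inv] at this
    exact_mod_cast le_antisymm (hinv g) this
  · obtain ⟨w, -, rfl, hlen⟩ := hex g
    rw [Nat.cast_eq_zero.1 hg, List.length_eq_zero_iff] at hlen
    rw [hlen, List.prod_nil]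
  · obtain ⟨n, hn⟩ := exists_nat_ge R
    have := hT.to_subtype
    refine ((List.finite_length_le T n).image fun w => (w.map Subtype.val).prod).subset ?_
    intro g hg
    obtain ⟨w, hw, rfl, hlen⟩ := hex g
    refine ⟨w.attach.map fun t => ⟨t.1, hw t.1 t.2⟩, ?_, ?_⟩
    · have : ((w.length : ℕ) : ℝ) ≤ n := hlen ▸ (le_trans hg hn)
      simpa using this
    · simp [Function.comp_def]

lemma exists_isBoxSpace [Group.FG G] (N : ℕ → FiniteIndexNormalSubgroup G) :
    ∃ (X : Type u) (_ : MetricSpace X), IsBoxSpace N X := by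
  obtain ⟨l, hl⟩ := exists_isProperLength (G := G)
  let : ∀ n, MetricSpace (G ⧸ (N n).toSubgroup) := fun n =>
    (quotientLength l (N n).toSubgroup hl).toNormedGroup.toMetricSpace
  let mσ : MetricSpace (Σ n, G ⧸ (N n).toSubgroup) := Metric.Sigma.metricSpace
  -- In the maximum metric of the product the second coordinate leaves each component unchanged and
  -- forces the required gaps between components.
  let j : (Σ n, G ⧸ (N n).toSubgroup) → (Σ n, G ⧸ (N n).toSubgroup) × ℝ := fun x => (x, 2 ^ x.1)
  have hj : Function.Injective j := fun x y h => congrArg Prod.fst h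
  refine ⟨Σ n, G ⧸ (N n).toSubgroup, MetricSpace.induced j hj inferInstance, l, hl, Sigma.fst,
    fun n => ⟨?_⟩, ⟨id, ⟨monotone_id, Filter.tendsto_id⟩, fun x y => ?_⟩, fun R _ n m _ => ?_⟩
  · let := MetricSpace.induced j hj inferInstance
    refine (IsometryEquiv.mk (Equiv.sigmaSubtype n).symm
      (Isometry.of_dist_eq fun q r => ?_)).symm
    change max (mσ.dist ⟨n, q⟩ ⟨n, r⟩) (dist ((2 : ℝ) ^ n) (2 ^ n)) = dist q r
    rw [dist_self, Metric.Sigma.dist_same, max_eq_left dist_nonneg]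
  · exact le_max_right _ _
  · let := MetricSpace.induced j hj inferInstance
    refine Set.Finite.isBounded ((Set.finite_range (Sigma.mk n)).subset ?_)
    rintro ⟨k, q⟩ ⟨rfl, -⟩
    exact ⟨q, rfl⟩

end Existence

/-! ## Property (A) of a box space implies amenability -/

section PropertyA

variable {G : Type*} [Group G] {N : ℕ → FiniteIndexNormalSubgroup G} {l : GroupNorm G}
  {X : Type*} [MetricSpace X] {p : X → ℕ} {pt : ∀ n, G ⧸ (N n).toSubgroup → X}

lemma norm_sub_sq_le_of_norm_one_sub_inner_le {H : Type*} [NormedAddCommGroup H]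
    [InnerProductSpace ℂ H] {a b : H} (ha : ‖a‖ = 1) (hb : ‖b‖ = 1) {ε : ℝ}
    (h : ‖1 - inner ℂ a b‖ ≤ ε) : ‖a - b‖ ^ 2 ≤ 2 * ε := by
  have h1 := (Complex.re_le_norm _).trans h
  rw [Complex.sub_re, Complex.one_re] at h1
  have h2 := norm_sub_sq (𝕜 := ℂ) a b
  rw [ha, hb] at h2
  have h3 : RCLike.re (inner ℂ a b) = (inner ℂ a b).re := rfl
  linarith

/-- On balls which embed into the quotient, functions on the quotient can be lifted to the group. -/
lemma IsBoxCoordinates.hasSum_lift (h : IsBoxCoordinates N l p pt) (hl : IsProperLength l) {n : ℕ}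
    {S : ℝ} (hS : ∀ g h : G, l g ≤ S → l h ≤ S → (g : G ⧸ (N n).toSubgroup) = h → g = h)
    (hn : ∀ x y, p x = n → dist x y ≤ S → p y = n) (q : G ⧸ (N n).toSubgroup)
    (v : lp (fun _ : X => ℂ) 2) (hv : ∀ y, v y ≠ 0 → dist (pt n q) y ≤ S) :
    HasSum (fun g : {g : G | l g ≤ S} => ‖v (pt n (q * (g : G)))‖ ^ 2) (‖v‖ ^ 2) := by
  have hinj : Function.Injective fun g : {g : G | l g ≤ S} =>
      pt n (q * ((g : G) : G ⧸ (N n).toSubgroup)) := fun g g' hg =>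
    Subtype.ext (hS _ _ g.2 g'.2 (mul_left_cancel (h.pt_injective n hg)))
  refine (hinj.hasSum_iff fun y hy => ?_).2 (hasSum_norm_sq v)
  by_contra hne
  have hvy := hv y (by rintro h0; simp [h0] at hne)
  have hpy := hn _ _ (h.index_pt n q) hvy
  obtain ⟨r, rfl⟩ : ∃ r, pt n r = y := hpy ▸ h.exists_pt y
  obtain ⟨g, hg, rfl⟩ := h.exists_eq_mul_of_dist_le hl hvy
  exact hy ⟨⟨g, hg⟩, rfl⟩

/-- In a component into which a large ball of `G` embeds, `φ (pt n q)` is read as a function of the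
displacement `g` from `q`. Taking for each `g` the root mean square over all base points `q` gives
an almost invariant unit vector on `G`. -/
lemma IsBoxCoordinates.isAmenable_of_hasPropertyA (h : IsBoxCoordinates N l p pt)
    (hl : IsProperLength l) (hN : ∀ g : G, g ≠ 1 → ∀ᶠ n in Filter.atTop, g ∉ N n)
    (hA : HasPropertyA X) : IsAmenable G := by
  classical
  intro E ε hε
  obtain ⟨R₀, hR₀⟩ := exists_forall_le_of_finite l E.finite_toSet
  set R := max R₀ 1 with hRdef
  have hR : 0 < R := lt_max_of_lt_right one_pos
  have hRE : ∀ g ∈ E, l g ≤ R := fun g hg => (hR₀ g hg).trans (le_max_left _ _)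
  -- For unit vectors, an inner product within `ε ^ 2 / 2` of 1 means a squared distance of at most
  -- `ε ^ 2`.
  obtain ⟨S, hS, φ, hφ1, hφ2, hφ3⟩ := hA R hR (ε ^ 2 / 2) (by positivity)
  -- The difference vector of `ξ` lives on the ball of radius `S + R`, and translating it by `g⁻¹`
  -- costs another `R`.
  set T := S + 2 * R with hT
  obtain ⟨m, hm⟩ := h.index_lt T
  -- a component into which the ball of radius `T` of the group embeds
  obtain ⟨n, hnm, hnN⟩ : ∃ n, m ≤ n ∧ ∀ g ∈ (hl (T + T)).toFinset \ {1}, g ∉ N n := by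
    have : ∀ᶠ n in Filter.atTop, ∀ g ∈ (hl (T + T)).toFinset \ {1}, g ∉ N n := by
      rw [Filter.eventually_all_finset]
      exact fun g hg => hN g fun h1 => (Finset.mem_sdiff.1 hg).2 (Finset.mem_singleton.2 h1)
    exact ((Filter.eventually_ge_atTop m).and this).exists
  have hinj : ∀ g k : G, l g ≤ T → l k ≤ T → (g : G ⧸ (N n).toSubgroup) = k → g = k := by
    intro g k hg hk hgk
    by_contra hne
    refine hnN (g⁻¹ * k) ?_ (QuotientGroup.eq.1 hgk)
    simp only [Finset.mem_sdiff, Set.Finite.mem_toFinset, Set.mem_ofPred_eq, Finset.mem_singleton,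
      inv_mul_eq_one]
    refine ⟨(map_mul_le_add l _ _).trans ?_, hne⟩
    rw [map_inv_eq_map]
    exact add_le_add hg hk
  have hcomp : ∀ x y, p x = n → dist x y ≤ T → p y = n := by
    intro x y hx hxy
    by_contra hy
    have := (hm x y (fun h => hy (h ▸ hx)) hxy).1
    lia
  have := Fintype.ofFinite (G ⧸ (N n).toSubgroup)
  set c : ℝ := (Fintype.card (G ⧸ (N n).toSubgroup) : ℝ) with hc
  have hc0 : 0 < c := by
    rw [hc]
    exact_mod_cast Fintype.card_pos
  let η : G → EuclideanSpace ℂ (G ⧸ (N n).toSubgroup) := fun g =>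
    WithLp.toLp 2 fun q => if l g ≤ S then φ (pt n q) (pt n (q * (g : G ⧸ (N n).toSubgroup))) else 0
  -- The cutoff at `S` is harmless on the ball of radius `T`: a nonzero value comes from a
  -- representative of length at most `S`, which is `g` itself by injectivity.
  have hη : ∀ g, l g ≤ T → ∀ q, η g q = φ (pt n q) (pt n (q * (g : G ⧸ (N n).toSubgroup))) := by
    intro g hg q
    simp only [η]
    split_ifs with hgS
    · rfl
    by_contra hne
    have hmem := hφ3 (pt n q) (Ne.symm hne)
    rw [Metric.mem_closedBall, dist_comm] at hmem
    obtain ⟨k, hk, hkg⟩ := h.exists_eq_mul_of_dist_le hl hmem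
    obtain rfl := hinj g k hg (by linarith) (mul_left_cancel hkg)
    exact hgS hk
  have hη0 : ∀ g, S < l g → η g = 0 := by
    intro g hg
    ext q
    simp [η, hg.not_ge]
  let B : Finset G := (hl T).toFinset
  have hB : ∀ g, g ∈ B ↔ l g ≤ T := fun g => Set.Finite.mem_toFinset _
  obtain ⟨ξ, hξ⟩ : ∃ ξ : lp (fun _ : G => ℂ) 2, ∀ g, ξ g = ((‖η g‖ / √c : ℝ) : ℂ) := by
    refine ⟨⟨fun g => ((‖η g‖ / √c : ℝ) : ℂ), ?_⟩, fun g => rfl⟩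
    refine (memℓp_zero (B.finite_toSet.subset fun g hg => ?_)).of_exponent_ge zero_le
    rw [Finset.mem_coe, hB]
    by_contra! hlt
    exact hg (by simp [hη0 g (by linarith)])
  have hlift : ∀ (q : G ⧸ (N n).toSubgroup) (v : lp (fun _ : X => ℂ) 2),
      (∀ y, v y ≠ 0 → dist (pt n q) y ≤ T) →
      ∑ g ∈ B, ‖v (pt n (q * (g : G ⧸ (N n).toSubgroup)))‖ ^ 2 = ‖v‖ ^ 2 := by
    intro q v hv
    rw [← (h.hasSum_lift hl hinj hcomp q v hv).tsum_eq, ← Finset.tsum_subtype']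
    exact (Equiv.subtypeEquivRight fun g => hB g).tsum_eq
      fun g : {g : G | l g ≤ T} => ‖v (pt n (q * ((g : G) : G ⧸ (N n).toSubgroup)))‖ ^ 2
  have hsupp : ∀ q y, φ (pt n q) y ≠ 0 → dist (pt n q) y ≤ S := by
    intro q y hy
    have := hφ3 (pt n q) hy
    rwa [Metric.mem_closedBall, dist_comm] at this
  refine ⟨ξ, ?_, fun g hg => ?_⟩
  · have h1 := hasSum_norm_sq ξ
    have h2 : HasSum (fun g => ‖ξ g‖ ^ 2) (∑ g ∈ B, ‖ξ g‖ ^ 2) := by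
      refine hasSum_sum_of_ne_finset_zero fun g hg => ?_
      rw [hB, not_le] at hg
      simp [hξ, hη0 g (by linarith)]
    have h3 : ∑ g ∈ B, ‖ξ g‖ ^ 2 = 1 := by
      calc ∑ g ∈ B, ‖ξ g‖ ^ 2 = ∑ g ∈ B, ∑ q,
            ‖φ (pt n q) (pt n (q * (g : G ⧸ (N n).toSubgroup)))‖ ^ 2 / c := by
            refine Finset.sum_congr rfl fun g hg => ?_
            rw [hξ, Complex.norm_real, Real.norm_eq_abs, sq_abs, div_pow, Real.sq_sqrt hc0.le,
              EuclideanSpace.norm_sq_eq, Finset.sum_div]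
            exact Finset.sum_congr rfl fun q _ => by rw [hη g ((hB g).1 hg)]
        _ = ∑ q : G ⧸ (N n).toSubgroup, 1 / c := by
            rw [Finset.sum_comm]
            refine Finset.sum_congr rfl fun q _ => ?_
            rw [← Finset.sum_div, hlift q _ fun y hy => (hsupp q y hy).trans (by linarith), hφ1,
              one_pow]
        _ = 1 := by
            rw [Finset.sum_const, nsmul_eq_mul, Finset.card_univ, ← hc, mul_one_div,
              div_self hc0.ne']
    have h4 := h1.unique h2
    rw [h3] at h4
    exact (pow_eq_one_iff_of_nonneg (norm_nonneg _) two_ne_zero).1 h4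
  · have hlg := hRE g hg
    have h1 := hasSum_norm_leftRegular_sub_sq g ξ
    have hlk : ∀ k, l k ≤ l (g⁻¹ * k) + R := fun k => by
      have := map_mul_le_add l g (g⁻¹ * k)
      rw [mul_inv_cancel_left] at this
      linarith
    have hlk' : ∀ k, l (g⁻¹ * k) ≤ l k + R := fun k => by
      have := map_mul_le_add l g⁻¹ k
      rw [map_inv_eq_map] at this
      linarith
    let B' : Finset G := (hl (S + R)).toFinset
    have hB' : ∀ g, g ∈ B' ↔ l g ≤ S + R := fun g => Set.Finite.mem_toFinset _
    have h2 : HasSum (fun k => ‖ξ (g⁻¹ * k) - ξ k‖ ^ 2)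
        (∑ k ∈ B', ‖ξ (g⁻¹ * k) - ξ k‖ ^ 2) := by
      refine hasSum_sum_of_ne_finset_zero fun k hk => ?_
      rw [hB', not_le] at hk
      simp [hξ, hη0 k (by linarith), hη0 (g⁻¹ * k) (by linarith [hlk k])]
    have h3 : ∑ k ∈ B', ‖ξ (g⁻¹ * k) - ξ k‖ ^ 2 ≤ ε ^ 2 := by
      calc ∑ k ∈ B', ‖ξ (g⁻¹ * k) - ξ k‖ ^ 2
          ≤ ∑ k ∈ B', ∑ q, ‖(φ (pt n (q * (g : G ⧸ (N n).toSubgroup))) - φ (pt n q))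
              (pt n (q * (k : G ⧸ (N n).toSubgroup)))‖ ^ 2 / c := by
            refine Finset.sum_le_sum fun k hk => ?_
            rw [hB'] at hk
            -- Moving the base point by `g` preserves the norm and makes both vectors refer to the
            -- same target point `q * k`, so that `φ` is compared at neighbouring base points.
            let η' : EuclideanSpace ℂ (G ⧸ (N n).toSubgroup) :=
              WithLp.toLp 2 fun q => η (g⁻¹ * k) (q * (g : G ⧸ (N n).toSubgroup))
            have hη' : ‖η'‖ ^ 2 = ‖η (g⁻¹ * k)‖ ^ 2 := by
              rw [EuclideanSpace.norm_sq_eq, EuclideanSpace.norm_sq_eq]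
              exact Equiv.sum_comp (Equiv.mulRight (g : G ⧸ (N n).toSubgroup))
                fun q => ‖η (g⁻¹ * k) q‖ ^ 2
            have hη'' : ‖η'‖ = ‖η (g⁻¹ * k)‖ :=
              (sq_eq_sq₀ (norm_nonneg _) (norm_nonneg _)).1 hη'
            have h5 : ‖ξ (g⁻¹ * k) - ξ k‖ ^ 2 ≤ ‖η' - η k‖ ^ 2 / c := by
              rw [hξ, hξ, ← Complex.ofReal_sub, Complex.norm_real, Real.norm_eq_abs, sq_abs, ← sub_div,
                div_pow, Real.sq_sqrt hc0.le, ← hη'']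
              refine div_le_div_of_nonneg_right ?_ hc0.le
              rw [← sq_abs]
              exact pow_le_pow_left₀ (abs_nonneg _) (abs_norm_sub_norm_le _ _) 2
            refine h5.trans (le_of_eq ?_)
            rw [EuclideanSpace.norm_sq_eq, Finset.sum_div]
            refine Finset.sum_congr rfl fun q _ => ?_
            have h6 : (η' - η k) q = η (g⁻¹ * k) (q * (g : G ⧸ (N n).toSubgroup)) - η k q := rfl
            rw [h6, hη k (by linarith), hη (g⁻¹ * k) (by linarith [hlk' k]), QuotientGroup.mk_mul,
              QuotientGroup.mk_inv, mul_assoc, mul_inv_cancel_left]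
            rfl
        _ ≤ ∑ k ∈ B, ∑ q, ‖(φ (pt n (q * (g : G ⧸ (N n).toSubgroup))) - φ (pt n q))
              (pt n (q * (k : G ⧸ (N n).toSubgroup)))‖ ^ 2 / c := by
            refine Finset.sum_le_sum_of_subset_of_nonneg (fun k hk => ?_)
              fun _ _ _ => Finset.sum_nonneg fun _ _ => by positivity
            rw [hB'] at hk
            rw [hB]
            linarith
        _ = ∑ q, ‖φ (pt n (q * (g : G ⧸ (N n).toSubgroup))) - φ (pt n q)‖ ^ 2 / c := by
            rw [Finset.sum_comm]
            refine Finset.sum_congr rfl fun q _ => ?_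
            rw [← Finset.sum_div, hlift q]
            intro y hy
            by_cases hy1 : φ (pt n q) y = 0
            · have hy2 : φ (pt n (q * (g : G ⧸ (N n).toSubgroup))) y ≠ 0 := by
                intro h0
                refine hy ?_
                change φ (pt n (q * (g : G ⧸ (N n).toSubgroup))) y - φ (pt n q) y = 0
                rw [h0, hy1, sub_zero]
              have := dist_triangle (pt n q) (pt n (q * (g : G ⧸ (N n).toSubgroup))) y
              linarith [hsupp _ _ hy2, h.dist_pt_mul_le q g]
            · linarith [hsupp _ _ hy1]
        _ ≤ ∑ q : G ⧸ (N n).toSubgroup, ε ^ 2 / c := by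
            refine Finset.sum_le_sum fun q _ => div_le_div_of_nonneg_right ?_ hc0.le
            refine (norm_sub_sq_le_of_norm_one_sub_inner_le (hφ1 _) (hφ1 _)
              (hφ2 _ _ ?_)).trans (by linarith)
            rw [dist_comm]
            exact (h.dist_pt_mul_le q g).trans hlg
        _ = ε ^ 2 := by
            rw [Finset.sum_const, nsmul_eq_mul, Finset.card_univ, ← hc]
            field_simp
    exact (pow_le_pow_iff_left₀ (norm_nonneg _) hε.le two_ne_zero).1 ((h1.unique h2).le.trans h3)

end PropertyA

/-! ## Free products are not amenable -/

section NonAmenable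

variable {A : Type u} {B : Type v} [Group A] [Group B]

/-- The elements with an alternating word that does not start with a letter of the factor `i`. -/
def notStarting (A : Type u) (B : Type v) [Group A] [Group B] (i : Bool) : Set (Coprod A B) :=
  {g | ∃ w, IsAlternating ⊥ w ∧ wordProd w = g ∧ ∀ x ∈ w.head?, x.1 ≠ i}

lemma notStarting_union : notStarting A B true ∪ notStarting A B false = Set.univ := by
  refine Set.eq_univ_of_forall fun g => ?_
  obtain ⟨w, hw, rfl⟩ := exists_isAlternating g
  match w, hw with
  | [], hw => exact Or.inl ⟨[], hw, rfl, by simp⟩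
  | (false, s) :: t, hw => exact Or.inl ⟨_, hw, rfl, by simp⟩
  | (true, s) :: t, hw => exact Or.inr ⟨_, hw, rfl, by simp⟩

lemma IsAlternating.inverse {w : List (Bool × Coprod A B)} (hw : IsAlternating ⊥ w) :
    IsAlternating ⊥ (w.map fun x => (x.1, x.2⁻¹)).reverse := by
  refine ⟨?_, fun x hx => ?_⟩
  · rw [List.isChain_reverse, List.isChain_map]
    exact hw.1.imp fun _ _ h => h.symm
  · rw [List.mem_reverse, List.mem_map] at hx
    obtain ⟨y, hy, rfl⟩ := hx
    exact ⟨inv_mem (hw.2 y hy).1, fun h => (hw.2 y hy).2 (by simpa using h)⟩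

lemma wordProd_inverse (w : List (Bool × Coprod A B)) :
    wordProd (w.map fun x => (x.1, x.2⁻¹)).reverse = (wordProd w)⁻¹ := by
  rw [wordProd, wordProd, List.prod_inv_reverse, List.map_reverse, List.map_map, List.map_map]
  rfl

/-- Otherwise `g⁻¹ * (s⁻¹ * t) * k` would be a nonempty alternating word with product 1. -/
lemma eq_of_mul_notStarting
    (hfree : ∀ w : List (Bool × Coprod A B), IsAlternating ⊥ w → w ≠ [] → wordProd w ≠ 1)
    {i : Bool} {s t g k : Coprod A B} (hs : s ∈ factor A B i) (ht : t ∈ factor A B i)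
    (hg : g ∈ notStarting A B i) (hk : k ∈ notStarting A B i) (h : s * g = t * k) : s = t := by
  obtain ⟨w, hw, rfl, hwi⟩ := hg
  obtain ⟨w', hw', rfl, hwi'⟩ := hk
  by_contra hne
  refine hfree ((w.map fun x => (x.1, x.2⁻¹)).reverse ++ (i, s⁻¹ * t) :: w') ⟨?_, ?_⟩ (by simp) ?_
  · rw [List.isChain_append, List.isChain_cons]
    refine ⟨hw.inverse.1, ⟨fun y hy => (hwi' y hy).symm, hw'.1⟩, ?_⟩
    intro x hx y hy
    rw [List.getLast?_reverse, List.head?_map, Option.mem_def, Option.map_eq_some_iff] at hx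
    obtain ⟨z, hz, rfl⟩ := hx
    simp only [List.head?_cons, Option.mem_def, Option.some.injEq] at hy
    exact hy ▸ hwi z hz
  · intro x hx
    rcases List.mem_append.1 hx with hx | hx
    · exact hw.inverse.2 x hx
    rcases List.mem_cons.1 hx with rfl | hx
    · exact ⟨mul_mem (inv_mem hs) ht, fun h1 => hne (by simpa [inv_mul_eq_one] using h1)⟩
    · exact hw'.2 x hx
  · rw [wordProd_append, wordProd_inverse, wordProd_cons, mul_assoc, ← h]
    group

/-- The density `‖ξ‖²` gives `W` at most the mass of its translate by `g`, up to the `ℓ¹` error. -/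
lemma tsum_indicator_le_add {G : Type*} [Group G] {ξ : lp (fun _ : G => ℂ) 2} (hξ : ‖ξ‖ = 1)
    {g : G} {δ : ℝ} (hδ : 0 < δ) (hg : ‖leftRegular g⁻¹ ξ - ξ‖ ≤ δ) (W : Set G) :
    ∑' x, W.indicator (fun x => ENNReal.ofReal (‖ξ x‖ ^ 2)) x ≤
      ∑' x, (W.indicator 1 (g⁻¹ * x) * ENNReal.ofReal (‖ξ x‖ ^ 2)) + ENNReal.ofReal (3 * δ) := by
  rw [← (Equiv.mulLeft g).tsum_eq fun x =>
    (W.indicator 1 (g⁻¹ * x) * ENNReal.ofReal (‖ξ x‖ ^ 2) : ℝ≥0∞)]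
  refine le_trans ?_ (add_le_add_right (tsum_ofReal_abs_norm_sq_sub_le hξ hδ hg) _)
  rw [← ENNReal.tsum_add]
  refine ENNReal.tsum_le_tsum fun x => ?_
  by_cases hx : x ∈ W
  · simp only [Equiv.coe_mulLeft, inv_mul_cancel_left, inv_inv, Set.indicator_of_mem hx,
      Pi.one_apply, one_mul]
    rw [← ENNReal.ofReal_add (by positivity) (by positivity)]
    refine ENNReal.ofReal_le_ofReal ?_
    have := neg_abs_le (‖ξ (g * x)‖ ^ 2 - ‖ξ x‖ ^ 2)
    linarith
  · simp [Set.indicator_of_notMem hx]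

/-- The translates of the set by three distinct elements of the factor `i` are disjoint and have
nearly the same mass as the set, so that mass is at most about one third. -/
lemma three_mul_tsum_notStarting_le
    (hfree : ∀ w : List (Bool × Coprod A B), IsAlternating ⊥ w → w ≠ [] → wordProd w ≠ 1)
    {i : Bool} {s : Fin 3 → Coprod A B} (hs : ∀ j, s j ∈ factor A B i) (hinj : s.Injective)
    {ξ : lp (fun _ : Coprod A B => ℂ) 2} (hξ : ‖ξ‖ = 1) {δ : ℝ} (hδ : 0 < δ)
    (hsδ : ∀ j, ‖leftRegular (s j)⁻¹ ξ - ξ‖ ≤ δ) :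
    3 * ∑' x, (notStarting A B i).indicator (fun x => ENNReal.ofReal (‖ξ x‖ ^ 2)) x ≤
      1 + 3 * ENNReal.ofReal (3 * δ) := by
  classical
  have hsum : ∑' x, ENNReal.ofReal (‖ξ x‖ ^ 2) = 1 := by
    have := hasSum_norm_sq ξ
    rw [hξ, one_pow] at this
    rw [← ENNReal.ofReal_tsum_of_nonneg (fun x => by positivity) this.summable, this.tsum_eq,
      ENNReal.ofReal_one]
  have hdisj : ∀ x, ∑ j, ((notStarting A B i).indicator 1 ((s j)⁻¹ * x) : ℝ≥0∞) ≤ 1 := by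
    intro x
    by_cases hx : ∃ j, (s j)⁻¹ * x ∈ notStarting A B i
    · obtain ⟨j, hj⟩ := hx
      rw [Finset.sum_eq_single j]
      · rw [Set.indicator_of_mem hj, Pi.one_apply]
      · intro k _ hkj
        refine Set.indicator_of_notMem (fun hk => hkj (hinj ?_)) _
        exact eq_of_mul_notStarting hfree (hs k) (hs j) hk hj (by simp)
      · simp
    · push Not at hx
      simp [hx]
  calc 3 * ∑' x, (notStarting A B i).indicator (fun x => ENNReal.ofReal (‖ξ x‖ ^ 2)) x
      = ∑ _j : Fin 3, ∑' x,
        (notStarting A B i).indicator (fun x => ENNReal.ofReal (‖ξ x‖ ^ 2)) x := by simp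
    _ ≤ ∑ j, (∑' x, ((notStarting A B i).indicator 1 ((s j)⁻¹ * x) *
          ENNReal.ofReal (‖ξ x‖ ^ 2)) + ENNReal.ofReal (3 * δ)) :=
        Finset.sum_le_sum fun j _ => tsum_indicator_le_add hξ hδ (hsδ j) _
    _ = ∑' x, (∑ j, (notStarting A B i).indicator 1 ((s j)⁻¹ * x)) * ENNReal.ofReal (‖ξ x‖ ^ 2) +
          3 * ENNReal.ofReal (3 * δ) := by
        rw [Finset.sum_add_distrib]
        simp only [Finset.sum_mul]
        rw [Summable.tsum_finsetSum fun _ _ => ENNReal.summable]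
        simp
    _ ≤ 1 + 3 * ENNReal.ofReal (3 * δ) := by
        gcongr
        rw [← hsum]
        exact ENNReal.tsum_le_tsum fun x => (mul_le_mul_left (hdisj x) _).trans (one_mul _).le

lemma exists_injective_fin_three {α : Type*} (h : 3 ≤ ENat.card α) :
    ∃ s : Fin 3 → α, s.Injective := by
  have hne : Nonempty α := by
    by_contra hempty
    rw [not_nonempty_iff] at hempty
    rw [ENat.card_eq_zero_iff_empty α |>.2 hempty] at h
    simp at h
  obtain ⟨b, hb, -⟩ := ENat.exists_ne_ne_of_three_le h hne.some hne.some
  obtain ⟨c, hc, hcb⟩ := ENat.exists_ne_ne_of_three_le h hne.some b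
  refine ⟨![hne.some, b, c], fun i j hij => ?_⟩
  fin_cases i <;> fin_cases j <;> simp_all [eq_comm]

/-- Two sets of mass about one third cannot cover the group. -/
lemma not_isAmenable_coprod
    (hfree : ∀ w : List (Bool × Coprod A B), IsAlternating ⊥ w → w ≠ [] → wordProd w ≠ 1)
    (hA : 3 ≤ ENat.card A) (hB : 3 ≤ ENat.card B) : ¬ IsAmenable (Coprod A B) := by
  classical
  intro hG
  obtain ⟨a, ha⟩ := exists_injective_fin_three hA
  obtain ⟨b, hb⟩ := exists_injective_fin_three hB
  let s : Fin 3 → Coprod A B := fun j => Coprod.inl (a j)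
  let t : Fin 3 → Coprod A B := fun j => Coprod.inr (b j)
  obtain ⟨ξ, hξ, hE⟩ := hG (Finset.univ.image (fun j => (s j)⁻¹) ∪
    Finset.univ.image (fun j => (t j)⁻¹)) (1 / 100) (by norm_num)
  have h1 := three_mul_tsum_notStarting_le hfree (i := true) (fun j => inl_mem_factor (a j))
    (Coprod.inl_injective.comp ha) hξ (by norm_num) fun j => hE _ (Finset.mem_union_left _
      (Finset.mem_image_of_mem _ (Finset.mem_univ j)))
  have h2 := three_mul_tsum_notStarting_le hfree (i := false) (fun j => inr_mem_factor (b j))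
    (Coprod.inr_injective.comp hb) hξ (by norm_num) fun j => hE _ (Finset.mem_union_right _
      (Finset.mem_image_of_mem _ (Finset.mem_univ j)))
  have hsum : ∑' x, ENNReal.ofReal (‖ξ x‖ ^ 2) = 1 := by
    have := hasSum_norm_sq ξ
    rw [hξ, one_pow] at this
    rw [← ENNReal.ofReal_tsum_of_nonneg (fun x => by positivity) this.summable, this.tsum_eq,
      ENNReal.ofReal_one]
  have h3 : (1 : ℝ≥0∞) ≤
      ∑' x, (notStarting A B true).indicator (fun x => ENNReal.ofReal (‖ξ x‖ ^ 2)) x +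
      ∑' x, (notStarting A B false).indicator (fun x => ENNReal.ofReal (‖ξ x‖ ^ 2)) x := by
    rw [← hsum, ← ENNReal.tsum_add]
    refine ENNReal.tsum_le_tsum fun x => ?_
    rcases (notStarting_union (A := A) (B := B)).ge (Set.mem_univ x) with hx | hx
    · rw [Set.indicator_of_mem hx]
      exact le_self_add
    · rw [Set.indicator_of_mem (s := notStarting A B false) hx]
      exact le_add_self
  have h4 := (mul_le_mul_right h3 3).trans ((mul_add _ _ _).le.trans (add_le_add h1 h2))
  -- Three times the covering inequality would give `3 ≤ 109 / 50`.
  have h5 : (1 + 3 * ENNReal.ofReal (3 * (1 / 100)) + (1 + 3 * ENNReal.ofReal (3 * (1 / 100))) :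
      ℝ≥0∞) = ENNReal.ofReal (109 / 50) := by
    rw [show (3 : ℝ≥0∞) = ENNReal.ofReal 3 by simp, show (1 : ℝ≥0∞) = ENNReal.ofReal 1 by simp,
      ← ENNReal.ofReal_mul (by norm_num), ← ENNReal.ofReal_add (by norm_num) (by norm_num),
      ← ENNReal.ofReal_add (by norm_num) (by norm_num)]
    norm_num
  rw [h5, mul_one, show (3 : ℝ≥0∞) = ENNReal.ofReal 3 by simp,
    ENNReal.ofReal_le_ofReal_iff (by norm_num)] at h4
  norm_num at h4

end NonAmenable

/-! ### Finite generation of the free product, faithfulness and trivial intersection -/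

section Final

variable {A : Type u} {B : Type v} [Group A] [Group B]

lemma fg_coprod [Group.FG A] [Group.FG B] : Group.FG (Coprod A B) := by
  have h1 : (Coprod.inl : A →* Coprod A B).range.FG :=
    (Group.fg_iff_subgroup_fg _).1 (Group.fg_range _)
  have h2 : (Coprod.inr : B →* Coprod A B).range.FG :=
    (Group.fg_iff_subgroup_fg _).1 (Group.fg_range _)
  refine ⟨?_⟩
  rw [← Coprod.range_inl_sup_range_inr]
  exact h1.sup h2

lemma isFaithfulSequence_of_eventually {G : Type*} [Group G] {N : ℕ → FiniteIndexNormalSubgroup G}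
    (hN : ∀ g : G, g ≠ 1 → ∀ᶠ n in Filter.atTop, g ∉ N n) : IsFaithfulSequence N := by
  intro g hg
  have h := hN g hg
  rw [← Nat.cofinite_eq_atTop, Filter.eventually_cofinite] at h
  refine h.subset fun n hn => not_not.2 ?_
  have h1 : ((g * 1 : G) : G ⧸ (N n).toSubgroup) = ((1 : G) : G ⧸ (N n).toSubgroup) :=
    hn ((1 : G) : G ⧸ (N n).toSubgroup)
  rw [mul_one] at h1
  exact (QuotientGroup.eq_one_iff g).1 h1

lemma iInf_eq_bot_of_eventually {G : Type*} [Group G] {N : ℕ → FiniteIndexNormalSubgroup G}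
    (hN : ∀ g : G, g ≠ 1 → ∀ᶠ n in Filter.atTop, g ∉ N n) : (⨅ n, (N n).toSubgroup) = ⊥ := by
  refine (Subgroup.eq_bot_iff_forall _).2 fun g hg => ?_
  by_contra h1
  obtain ⟨n, hn⟩ := (hN g h1).exists
  exact hn (Subgroup.mem_iInf.1 hg n)

end Final

end BoxSpaces

end

theorem theorem1 (A : Type u) (B : Type v) [Group A] [Group B]
    [Group.FG A] [Group.FG B] [Group.ResiduallyFinite A] [Group.ResiduallyFinite B]
    (hA : BoxSpaces.IsAmenable A) (hB : BoxSpaces.IsAmenable B) :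
    (∃ N : ℕ → FiniteIndexNormalSubgroup (Monoid.Coprod A B),
      (⨅ n, (N n).toSubgroup) = ⊥ ∧
      BoxSpaces.IsFaithfulSequence N ∧
      (∃ (X : Type (max u v)) (_ : MetricSpace X), BoxSpaces.IsBoxSpace N X) ∧
      ∀ (X : Type w) [MetricSpace X], BoxSpaces.IsBoxSpace N X →
        BoxSpaces.CoarselyEmbedsIntoHilbert X ∧
        BoxSpaces.BoundedGeometry X ∧
        (3 ≤ ENat.card A → 3 ≤ ENat.card B → ¬ BoxSpaces.HasPropertyA X)) ∧
    (3 ≤ ENat.card A → 3 ≤ ENat.card B → ¬ BoxSpaces.IsAmenable (Monoid.Coprod A B)) := by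
  have := BoxSpaces.countable_of_fg (A := A)
  have := BoxSpaces.countable_of_fg (A := B)
  have := BoxSpaces.fg_coprod (A := A) (B := B)
  obtain ⟨N, hfree, hN⟩ := BoxSpaces.exists_isUniformlyHilbertian hA hB
  have havoid : ∀ g : Monoid.Coprod A B, g ≠ 1 → ∀ᶠ n in Filter.atTop, g ∉ N n := by
    intro g hg
    obtain ⟨w, hw, rfl⟩ := BoxSpaces.exists_isAlternating g
    exact hfree w hw (by rintro rfl; exact hg rfl)
  -- The normal form theorem is a by-product of the covers: a nonempty alternating word leaves some
  -- `N n`, so its product is not 1.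
  have hna : 3 ≤ ENat.card A → 3 ≤ ENat.card B → ¬ BoxSpaces.IsAmenable (Monoid.Coprod A B) :=
    BoxSpaces.not_isAmenable_coprod fun w hw hne h1 => by
      obtain ⟨n, hn⟩ := (hfree w hw hne).exists
      exact hn (h1 ▸ one_mem _)
  refine ⟨⟨N, BoxSpaces.iInf_eq_bot_of_eventually havoid,
    BoxSpaces.isFaithfulSequence_of_eventually havoid, BoxSpaces.exists_isBoxSpace N,
    fun X _ hX => ?_⟩, hna⟩
  obtain ⟨l, p, pt, hl, h⟩ := hX.exists_coordinates
  exact ⟨h.coarselyEmbedsIntoHilbert hl hN, h.boundedGeometry hl,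
    fun h1 h2 hX => hna h1 h2 (h.isAmenable_of_hasPropertyA hl havoid hX)⟩
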